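/- **Definitions.** An *SMC-category* is a bicategory $\mathbf B$ with a symmetric monoidal structure $(\oplus,\mathbf 0)$ on each category $\mathbf B(a,b)$, together with symmetric strong monoidal structures on the two adjoints of composition $$\mathbf B(b,c)\to\mathbf{CAT}(\mathbf B(a,b),\mathbf B(a,c)),\ g\mapsto g\circ-,\qquad \mathbf B(a,b)\to\mathbf{CAT}(\mathbf B(b,c),\mathbf B(a,c)),\ f\mapsto -\circ f,$$ where the functor categories carry the pointwise structure from $\mathbf B(a,c)$. (So each functor $g\circ-$ is strong monoidal through the second structure and each $-\circ f$ through the first.) It is required that the isomorphisms $(g\circ-)\oplus(g'\circ-)\cong(g\oplus g')\circ-$, $(-\circ f)\oplus(-\circ f')\cong-\circ(f\oplus f')$, $\mathbf 0\cong\mathbf 0\circ-$, $\mathbf 0\cong-\circ\mathbf 0$ and the associativity and unit isomorphisms $h\circ(g\circ-)\cong(h\circ g)\circ-$, $h\circ(-\circ f)\cong(h\circ-)\circ f$, $-\circ(g\circ f)\cong(-\circ g)\circ f$, $-\circ\mathbf 1\cong\mathrm{id}$, $\mathbf 1\circ-\cong\mathrm{id}$ are isomorphisms of monoidal functors. It is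 a *PC-category* if $\mathbf B$ is a strict $2$-category, each $\mathbf B(a,b)$ is permutative (strictly associative and unital), $g\mapsto g\circ-$ is strict monoidal and $f\mapsto-\circ f$ is strictly unital. An *SMC-functor* $F:\mathbf B\to\mathbf C$ is a pseudofunctor with symmetric strong monoidal structures on the functors $\mathbf B(a,b)\to\mathbf C(Fa,Fb)$ such that the isomorphisms $F(g)\circ F(f)\cong F(g\circ f)$ are monoidal in $f$ and in $g$. A *monoidal transformation* $\eta:F\Rightarrow G$ is a strong transformation such that, for all $a,b$, the isomorphisms $\eta_f:G(f)\circ\eta_a\cong\eta_b\circ F(f)$ form a monoidal transformation in $f\in\mathbf B(a,b)$. A *modification* of monoidal transformations is a modification in the sense of bicategories. $\mathbf{SMC\text{-}Cat}(\mathbf B,\mathbf C)$ is the bicategory of SMC-functors, monoidal transformations and modifications. **Corollary 7.2.** Let $\mathbf B$ and $\mathbf C$ be SMC-categories. Then the bicategory $\mathbf{SMC\text{-}Cat}(\mathbf B,\mathbf C)$ is an SMC-category, with structure formed pointwise in $\mathbf C$: $(\eta\oplus\sigma)_b=\eta_b\oplus\sigma_b$; for $f:a\to b$, the $2$-cell $(\eta\oplus\sigma)_f$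 is the composite $$Gf\circ(\eta_a\oplus\sigma_a)\cong (Gf\circ\eta_a)\oplus(Gf\circ\sigma_a)\xrightarrow{\eta_f\oplus\sigma_f}(\eta_b\circ Ff)\oplus(\sigma_b\circ Ff)\cong(\eta_b\oplus\sigma_b)\circ Ff;$$ the unit is likewise the transformation with components $\mathbf 0$; and sums of modifications, the coherence isomorphisms of $\oplus$ and the distributivity and nullity isomorphisms are those of $\mathbf C$ in each component. If $\mathbf C$ is moreover a PC-category, then $\mathbf{SMC\text{-}Cat}(\mathbf B,\mathbf C)$ with this structure is a PC-category. -/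

import Mathlib

open CategoryTheory Bicategory
open scoped Pseudofunctor.StrongTrans

universe w₁ w₂ v₁ v₂ v₃ v₄ u₁ u₂ u₃ u₄

section MonoidalFunctors

open scoped MonoidalCategory

variable {C : Type u₁} [Category.{v₁} C] [MonoidalCategory C]
  {D : Type u₂} [Category.{v₂} D] [MonoidalCategory D]

/-- The pointwise sum `X ↦ F X ⊗ G X` of two strong monoidal functors with values in a braided
monoidal category is strong monoidal: its structure map is the middle-four interchange (built from
associativity and the braiding) followed by the structure maps of `F` and `G`. -/
instance monoidalTensorFunctor [BraidedCategory D] (F G : C ⥤ D) [F.Monoidal] [G.Monoidal] :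
    (F ⊗ G).Monoidal :=
  inferInstanceAs (Functor.prod' F G ⋙ MonoidalCategory.tensor D).Monoidal

/-- The constant functor at the monoidal unit is strong monoidal. -/
instance monoidalUnitFunctor : (𝟙_ (C ⥤ D)).Monoidal :=
  Functor.CoreMonoidal.toMonoidal
    { εIso := Iso.refl (𝟙_ D)
      μIso := fun _ _ => λ_ (𝟙_ D)
      μIso_hom_natural_left := by intros; simp
      μIso_hom_natural_right := by intros; simp
      associativity := by
        intros; simp [MonoidalCategory.unitors_equal]
      left_unitality := by intros; simp
      right_unitality := by intros; simp [MonoidalCategory.unitors_equal] }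

/-- Evaluation of functors at an object is strong monoidal for the pointwise structure. -/
instance evaluationMonoidal (C : Type u₁) [Category.{v₁} C] (X : C) :
    ((evaluation C D).obj X).Monoidal :=
  Functor.CoreMonoidal.toMonoidal
    { εIso := Iso.refl (𝟙_ D)
      μIso := fun _ _ => Iso.refl _ }

/-- A (lax) monoidal functor is strictly unital if it preserves the unit object on the nose, and
its unit constraint is the identity. -/
def IsStrictlyUnital (F : C ⥤ D) [F.LaxMonoidal] : Prop :=
  ∃ h : 𝟙_ D = F.obj (𝟙_ C), Functor.LaxMonoidal.ε F = eqToHom h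

/-- A (lax) monoidal functor is strict monoidal if it is strictly unital, preserves tensor products
of objects on the nose, and its tensor constraints are identities. -/
def IsStrictMonoidal (F : C ⥤ D) [F.LaxMonoidal] : Prop :=
  IsStrictlyUnital F ∧
    ∀ X Y : C, ∃ h : F.obj X ⊗ F.obj Y = F.obj (X ⊗ Y), Functor.LaxMonoidal.μ F X Y = eqToHom h

variable (C) in
/-- A monoidal category is strict if tensoring objects is associative and unital on the nose, and
the associators and unitors are identities. A permutative category is a symmetric monoidal category
that is strict in this sense. -/
class IsStrictMonoidalCategory : Prop where
  associator_eq (X Y Z : C) : ∃ h : (X ⊗ Y) ⊗ Z = X ⊗ (Y ⊗ Z),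
    (MonoidalCategoryStruct.associator X Y Z).hom = eqToHom h
  leftUnitor_eq (X : C) : ∃ h : 𝟙_ C ⊗ X = X,
    (MonoidalCategoryStruct.leftUnitor X).hom = eqToHom h
  rightUnitor_eq (X : C) : ∃ h : X ⊗ 𝟙_ C = X,
    (MonoidalCategoryStruct.rightUnitor X).hom = eqToHom h

theorem isMonoidal_comp {F G H : C ⥤ D} [F.LaxMonoidal] [G.LaxMonoidal] [H.LaxMonoidal]
    {σ : F ⟶ G} {τ : G ⟶ H} (hσ : NatTrans.IsMonoidal σ) (hτ : NatTrans.IsMonoidal τ) :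
    NatTrans.IsMonoidal (σ ≫ τ) := inferInstance

variable {E : Type u₃} [Category.{v₃} E] [MonoidalCategory E]
  {E' : Type u₄} [Category.{v₄} E'] [MonoidalCategory E']

theorem isMonoidal_assoc (F : C ⥤ D) (G : D ⥤ E) (H : E ⥤ E') [F.LaxMonoidal] [G.LaxMonoidal]
    [H.LaxMonoidal] : NatTrans.IsMonoidal (Functor.associator F G H).hom := inferInstance

theorem isMonoidal_assoc_inv (F : C ⥤ D) (G : D ⥤ E) (H : E ⥤ E') [F.LaxMonoidal] [G.LaxMonoidal]
    [H.LaxMonoidal] : NatTrans.IsMonoidal (Functor.associator F G H).inv := inferInstance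

end MonoidalFunctors

/-- The structure carried by an `SMC`-category, before the coherence conditions: symmetric monoidal
structures on the hom-categories, and symmetric strong monoidal structures on the two adjoints of
composition `g ↦ g ∘ -` and `f ↦ - ∘ f` (functor categories carry the pointwise symmetric monoidal
structure). Composition is in diagrammatic order: `g ∘ f` is `f ≫ g`. -/
class SMCData (B : Type u₁) [Bicategory.{w₁, v₁} B] where
  homMonoidal (a b : B) : MonoidalCategory (a ⟶ b)
  homSymmetric (a b : B) : SymmetricCategory (a ⟶ b)
  postcomposingBraided (a b c : B) : (postcomposing a b c).Braided
  precomposingBraided (a b c : B) : (precomposing a b c).Braided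

attribute [reducible, instance] SMCData.homMonoidal SMCData.homSymmetric SMCData.postcomposingBraided
  SMCData.precomposingBraided

section SMCData

variable {B : Type u₁} [Bicategory.{w₁, v₁} B] [SMCData B]

/-- For a 1-cell `g`, the functor `f ↦ g ∘ f` is strong monoidal, with
`(g ∘ f) ⊕ (g ∘ f') ≅ g ∘ (f ⊕ f')` given by the monoidal structure on `f ↦ - ∘ f`. -/
instance postcompMonoidal {a b c : B} (g : b ⟶ c) : ((postcomposing a b c).obj g).Monoidal :=
  inferInstanceAs (precomposing a b c ⋙ (evaluation _ _).obj g).Monoidal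

/-- For a 1-cell `f`, the functor `g ↦ g ∘ f` is strong monoidal, with
`(g ∘ f) ⊕ (g' ∘ f) ≅ (g ⊕ g') ∘ f` given by the monoidal structure on `g ↦ g ∘ -`. -/
instance precompMonoidal {a b c : B} (f : a ⟶ b) : ((precomposing a b c).obj f).Monoidal :=
  inferInstanceAs (postcomposing a b c ⋙ (evaluation _ _).obj f).Monoidal

end SMCData

/-- An `SMC`-category (category weakly enriched in symmetric monoidal categories): a bicategory with
symmetric monoidal hom-categories and bilinear composition, such that the distributivity and nullity
isomorphisms, and the associativity and unit isomorphisms of the bicategory, are isomorphisms of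
monoidal functors in each variable. -/
class SMCCategory (B : Type u₁) [Bicategory.{w₁, v₁} B] extends SMCData B where
  /-- `(g ∘ -) ⊕ (g' ∘ -) ≅ (g ⊕ g') ∘ -` is monoidal. -/
  postcomposing_μ {a b c : B} (g g' : b ⟶ c) :
    NatTrans.IsMonoidal (Functor.LaxMonoidal.μ (postcomposing a b c) g g')
  /-- `(- ∘ f) ⊕ (- ∘ f') ≅ - ∘ (f ⊕ f')` is monoidal. -/
  precomposing_μ {a b c : B} (f f' : a ⟶ b) :
    NatTrans.IsMonoidal (Functor.LaxMonoidal.μ (precomposing a b c) f f')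
  /-- `𝟎 ≅ 𝟎 ∘ -` is monoidal. -/
  postcomposing_ε (a b c : B) : NatTrans.IsMonoidal (Functor.LaxMonoidal.ε (postcomposing a b c))
  /-- `𝟎 ≅ - ∘ 𝟎` is monoidal. -/
  precomposing_ε (a b c : B) : NatTrans.IsMonoidal (Functor.LaxMonoidal.ε (precomposing a b c))
  /-- `h ∘ (g ∘ -) ≅ (h ∘ g) ∘ -` is monoidal. -/
  associator_left (a : B) {b c d : B} (g : b ⟶ c) (h : c ⟶ d) :
    NatTrans.IsMonoidal (associatorNatIsoLeft a g h).hom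
  /-- `h ∘ (- ∘ f) ≅ (h ∘ -) ∘ f` is monoidal. -/
  associator_middle {a b c d : B} (f : a ⟶ b) (h : c ⟶ d) :
    NatTrans.IsMonoidal (associatorNatIsoMiddle f h).hom
  /-- `- ∘ (g ∘ f) ≅ (- ∘ g) ∘ f` is monoidal. -/
  associator_right {a b c : B} (f : a ⟶ b) (g : b ⟶ c) (d : B) :
    NatTrans.IsMonoidal (associatorNatIsoRight f g d).hom
  /-- `- ∘ 𝟏 ≅ id` is monoidal. -/
  leftUnitor (a b : B) : NatTrans.IsMonoidal (leftUnitorNatIso a b).hom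
  /-- `𝟏 ∘ - ≅ id` is monoidal. -/
  rightUnitor (a b : B) : NatTrans.IsMonoidal (rightUnitorNatIso a b).hom

attribute [instance] SMCCategory.postcomposing_μ SMCCategory.precomposing_μ
  SMCCategory.postcomposing_ε SMCCategory.precomposing_ε SMCCategory.associator_left
  SMCCategory.associator_middle SMCCategory.associator_right SMCCategory.leftUnitor
  SMCCategory.rightUnitor

/-- An `SMC`-category is a `PC`-category if the bicategory is a strict 2-category, the
hom-categories are permutative, `g ↦ g ∘ -` is strict monoidal, and `f ↦ - ∘ f` (which is strong
monoidal) is strictly unital. -/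
class IsPCCategory (B : Type u₁) [Bicategory.{w₁, v₁} B] [SMCCategory B] : Prop where
  strict : Bicategory.Strict B
  homStrict (a b : B) : IsStrictMonoidalCategory (a ⟶ b)
  postcomposing_strict (a b c : B) : IsStrictMonoidal (postcomposing a b c)
  precomposing_unital (a b c : B) : IsStrictlyUnital (precomposing a b c)

section Functors

variable {B : Type u₁} [Bicategory.{w₁, v₁} B] {C : Type u₂} [Bicategory.{w₂, v₂} C]

/-- The isomorphisms `F (g ∘ f) ≅ F g ∘ F f`, for fixed `f`, as a natural transformation in `g`. -/
def mapCompPrecomp (F : B ⥤ᵖ C) {a b : B} (f : a ⟶ b) (c : B) :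
    (precomposing a b c).obj f ⋙ F.mapFunctor a c ⟶
      F.mapFunctor b c ⋙ (precomposing _ _ _).obj (F.map f) where
  app g := (F.mapComp f g).hom
  naturality g g' β := by
    change F.map₂ (f ◁ β) ≫ (F.mapComp f g').hom = (F.mapComp f g).hom ≫ F.map f ◁ F.map₂ β
    simp

/-- The isomorphisms `F (g ∘ f) ≅ F g ∘ F f`, for fixed `g`, as a natural transformation in `f`. -/
def mapCompPostcomp (F : B ⥤ᵖ C) (a : B) {b c : B} (g : b ⟶ c) :
    (postcomposing a b c).obj g ⋙ F.mapFunctor a c ⟶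
      F.mapFunctor a b ⋙ (postcomposing _ _ _).obj (F.map g) where
  app f := (F.mapComp f g).hom
  naturality f f' β := by
    change F.map₂ (β ▷ g) ≫ (F.mapComp f' g).hom = (F.mapComp f g).hom ≫ F.map₂ β ▷ F.map g
    simp

/-- The 2-cells `η_f : η_b ∘ F f ≅ G f ∘ η_a` of a transformation `η` as a natural transformation
in the 1-cell `f : a ⟶ b`. -/
def transNatTrans {F G : B ⥤ᵖ C} (η : F ⟶ G) (a b : B) :
    F.mapFunctor a b ⋙ (postcomposing _ _ _).obj (η.app b) ⟶
      G.mapFunctor a b ⋙ (precomposing _ _ _).obj (η.app a) where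
  app f := (η.naturality f).hom
  naturality _ _ β := η.naturality_naturality β

/-- The structure of an `SMC`-functor on a pseudofunctor between `SMC`-categories. A transformation
between functors into a functor category is monoidal for the pointwise structure iff it is so at
each object; this is how the two monoidality conditions are stated. -/
class SMCFunctorStructure [SMCCategory B] [SMCCategory C] (F : B ⥤ᵖ C) where
  mapBraided (a b : B) : (F.mapFunctor a b).Braided
  mapComp_precomp {a b : B} (f : a ⟶ b) (c : B) : NatTrans.IsMonoidal (mapCompPrecomp F f c)
  mapComp_postcomp (a : B) {b c : B} (g : b ⟶ c) : NatTrans.IsMonoidal (mapCompPostcomp F a g)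

attribute [reducible, instance] SMCFunctorStructure.mapBraided

attribute [instance] SMCFunctorStructure.mapComp_precomp SMCFunctorStructure.mapComp_postcomp

variable (B C) in
/-- An `SMC`-functor between `SMC`-categories. -/
structure SMCFunctor [SMCCategory B] [SMCCategory C] where
  toPseudofunctor : B ⥤ᵖ C
  [str : SMCFunctorStructure toPseudofunctor]

attribute [instance] SMCFunctor.str

variable [SMCCategory B] [SMCCategory C]

/-- A monoidal transformation between `SMC`-functors: a strong transformation `η` whose 2-cells
`η_f` form a monoidal transformation in `f : a ⟶ b`, for all `a`, `b`. -/
structure MonoidalTrans (F G : SMCFunctor B C) where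
  toTrans : F.toPseudofunctor ⟶ G.toPseudofunctor
  isMonoidal (a b : B) : NatTrans.IsMonoidal (transNatTrans toTrans a b)

attribute [instance] MonoidalTrans.isMonoidal

namespace MonoidalTrans

/-- The identity transformation of an `SMC`-functor is monoidal. -/
def id (F : SMCFunctor B C) : MonoidalTrans F F where
  toTrans := 𝟙 F.toPseudofunctor
  isMonoidal a b := by
    have h : NatTrans.IsMonoidal
        (Functor.whiskerLeft (F.toPseudofunctor.mapFunctor a b) (rightUnitorNatIso _ _).hom ≫
          Functor.whiskerLeft (F.toPseudofunctor.mapFunctor a b) (leftUnitorNatIso _ _).inv) :=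
      inferInstance
    exact h

/-- Composites of monoidal transformations are monoidal. -/
def comp {F G H : SMCFunctor B C} (η : MonoidalTrans F G) (θ : MonoidalTrans G H) :
    MonoidalTrans F H where
  toTrans := η.toTrans ≫ θ.toTrans
  isMonoidal a b := by
    have h₁ : NatTrans.IsMonoidal (Functor.whiskerLeft (F.toPseudofunctor.mapFunctor a b)
        (associatorNatIsoLeft _ (η.toTrans.app b) (θ.toTrans.app b)).inv) := inferInstance
    have h₂ : NatTrans.IsMonoidal (Functor.whiskerRight (transNatTrans η.toTrans a b)
        ((postcomposing _ _ _).obj (θ.toTrans.app b))) := inferInstance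
    have h₃ : NatTrans.IsMonoidal (Functor.whiskerLeft (G.toPseudofunctor.mapFunctor a b)
        (associatorNatIsoMiddle (η.toTrans.app a) (θ.toTrans.app b)).hom) := inferInstance
    have h₄ : NatTrans.IsMonoidal (Functor.whiskerRight (transNatTrans θ.toTrans a b)
        ((precomposing _ _ _).obj (η.toTrans.app a))) := inferInstance
    have h₅ : NatTrans.IsMonoidal (Functor.whiskerLeft (H.toPseudofunctor.mapFunctor a b)
        (associatorNatIsoRight (η.toTrans.app a) (θ.toTrans.app a) _).inv) := inferInstance
    have h := isMonoidal_comp h₁ <| isMonoidal_comp (isMonoidal_assoc_inv _ _ _) <|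
      isMonoidal_comp h₂ <| isMonoidal_comp (isMonoidal_assoc _ _ _) <|
      isMonoidal_comp h₃ <| isMonoidal_comp (isMonoidal_assoc_inv _ _ _) <|
      isMonoidal_comp h₄ <| isMonoidal_comp (isMonoidal_assoc _ _ _) h₅
    refine Eq.mp (congrArg (fun τ => NatTrans.IsMonoidal τ) ?_) h
    ext f
    simp only [NatTrans.comp_app, Functor.whiskerLeft_app, Functor.whiskerRight_app,
      Functor.associator_hom_app, Functor.associator_inv_app, associatorNatIsoLeft_inv_app,
      associatorNatIsoMiddle_hom_app, associatorNatIsoRight_inv_app]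
    refine Eq.trans ?_ (Pseudofunctor.StrongTrans.categoryStruct_comp_naturality_hom _ _ _).symm
    erw [Category.id_comp, Category.id_comp, Category.id_comp, Category.id_comp]
    rfl

end MonoidalTrans

/-- The category of monoidal transformations between two `SMC`-functors, with all modifications as
morphisms. -/
instance MonoidalTrans.category (F G : SMCFunctor B C) : Category (MonoidalTrans F G) where
  Hom η θ := η.toTrans ⟶ θ.toTrans
  id η := 𝟙 η.toTrans
  comp M N := M ≫ N
  id_comp M := Category.id_comp M
  comp_id M := Category.comp_id M
  assoc M N P := Category.assoc M N P

/-- An invertible modification, as an isomorphism of monoidal transformations. -/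
def MonoidalTrans.isoMk {F G : SMCFunctor B C} {η θ : MonoidalTrans F G}
    (e : η.toTrans ≅ θ.toTrans) : η ≅ θ where
  hom := e.hom
  inv := e.inv
  hom_inv_id := e.hom_inv_id
  inv_hom_id := e.inv_hom_id

/-- The bicategory of `SMC`-functors, monoidal transformations and modifications: 1-cells are
composed as strong transformations, and the 2-cells are all modifications, with the operations and
structure isomorphisms of the bicategory of pseudofunctors. -/
instance SMCFunctor.bicategory : Bicategory (SMCFunctor B C) where
  Hom F G := MonoidalTrans F G
  id F := MonoidalTrans.id F
  comp η θ := MonoidalTrans.comp η θ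
  homCategory F G := MonoidalTrans.category F G
  whiskerLeft {F G H} η θ ι M :=
    Bicategory.whiskerLeft η.toTrans (g := θ.toTrans) (h := ι.toTrans) M
  whiskerRight {F G H η θ} M ι :=
    Bicategory.whiskerRight (f := η.toTrans) (g := θ.toTrans) M ι.toTrans
  associator η θ ι := MonoidalTrans.isoMk (α_ η.toTrans θ.toTrans ι.toTrans)
  leftUnitor η := MonoidalTrans.isoMk (λ_ η.toTrans)
  rightUnitor η := MonoidalTrans.isoMk (ρ_ η.toTrans)
  whiskerLeft_id η θ := Bicategory.whiskerLeft_id η.toTrans θ.toTrans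
  whiskerLeft_comp η _ _ _ M N := Bicategory.whiskerLeft_comp η.toTrans M N
  id_whiskerLeft {F G η θ} M :=
    by exact Bicategory.id_whiskerLeft (f := η.toTrans) (g := θ.toTrans) M
  comp_whiskerLeft η θ _ _ M := Bicategory.comp_whiskerLeft η.toTrans θ.toTrans M
  id_whiskerRight η θ := Bicategory.id_whiskerRight η.toTrans θ.toTrans
  comp_whiskerRight M N θ := Bicategory.comp_whiskerRight M N θ.toTrans
  whiskerRight_id {F G η θ} M :=
    by exact Bicategory.whiskerRight_id (f := η.toTrans) (g := θ.toTrans) M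
  whiskerRight_comp M η θ := Bicategory.whiskerRight_comp M η.toTrans θ.toTrans
  whisker_assoc η _ _ M θ := Bicategory.whisker_assoc η.toTrans M θ.toTrans
  whisker_exchange {F G H η θ ι κ} M N :=
    Bicategory.whisker_exchange (f := η.toTrans) (g := θ.toTrans) (h := ι.toTrans)
      (i := κ.toTrans) M N
  pentagon η θ ι κ := Bicategory.pentagon η.toTrans θ.toTrans ι.toTrans κ.toTrans
  triangle η θ := by exact Bicategory.triangle η.toTrans θ.toTrans

/-- The strong transformation underlying a 1-cell of the bicategory of `SMC`-functors. -/
def SMCFunctor.trans {F G : SMCFunctor B C} (η : F ⟶ G) :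
    F.toPseudofunctor ⟶ G.toPseudofunctor :=
  MonoidalTrans.toTrans (F := F) (G := G) η

/-- The modification that a 2-cell of the bicategory of `SMC`-functors is. -/
def SMCFunctor.modif {F G : SMCFunctor B C} {η θ : F ⟶ G} (M : η ⟶ θ) :
    Pseudofunctor.StrongTrans.Modification (SMCFunctor.trans η) (SMCFunctor.trans θ) :=
  Pseudofunctor.StrongTrans.Hom.as (η := SMCFunctor.trans η) (θ := SMCFunctor.trans θ) M

variable (B C) in
/-- Evaluation at a 0-cell `b`, as a (strict) pseudofunctor. -/
def SMCFunctor.eval (b : B) : SMCFunctor B C ⥤ᵖ C where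
  obj F := F.toPseudofunctor.obj b
  map η := (SMCFunctor.trans η).app b
  map₂ M := (SMCFunctor.modif M).app b
  map₂_id _ := rfl
  map₂_comp _ _ := rfl
  mapId F := Iso.refl (𝟙 (F.toPseudofunctor.obj b))
  mapComp η θ := Iso.refl ((SMCFunctor.trans η).app b ≫ (SMCFunctor.trans θ).app b)
  map₂_whisker_left _ _ _ _ := ((Category.id_comp _).trans (Category.comp_id _)).symm
  map₂_whisker_right _ _ := ((Category.id_comp _).trans (Category.comp_id _)).symm
  map₂_associator η θ ι := by
    have h {x y z w : C} (f : x ⟶ y) (g : y ⟶ z) (h : z ⟶ w) : (α_ f g h).hom =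
        𝟙 _ ≫ 𝟙 (f ≫ g) ▷ h ≫ (α_ f g h).hom ≫ f ◁ 𝟙 (g ≫ h) ≫ 𝟙 _ := by simp
    exact h ((SMCFunctor.trans η).app b) ((SMCFunctor.trans θ).app b) ((SMCFunctor.trans ι).app b)
  map₂_left_unitor η := by
    have h {x y : C} (f : x ⟶ y) : (λ_ f).hom = 𝟙 _ ≫ 𝟙 (𝟙 x) ▷ f ≫ (λ_ f).hom := by simp
    exact h ((SMCFunctor.trans η).app b)
  map₂_right_unitor η := by
    have h {x y : C} (f : x ⟶ y) : (ρ_ f).hom = 𝟙 _ ≫ f ◁ 𝟙 (𝟙 y) ≫ (ρ_ f).hom := by simp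
    exact h ((SMCFunctor.trans η).app b)

/-- A 1-cell `F f`, as a 1-cell between the values of the evaluations at the end points of `f`. -/
def SMCFunctor.evalMap (F : SMCFunctor B C) {a b : B} (f : a ⟶ b) :
    (SMCFunctor.eval B C a).obj F ⟶ (SMCFunctor.eval B C b).obj F :=
  F.toPseudofunctor.map f

/-- For a 1-cell `f : a ⟶ b`, the 2-cells `η_f : η_b ∘ F f ≅ G f ∘ η_a`, as a natural transformation
in the monoidal transformation `η : F ⟶ G`. -/
def SMCFunctor.evalNatTrans (F G : SMCFunctor B C) {a b : B} (f : a ⟶ b) :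
    (SMCFunctor.eval B C b).mapFunctor F G ⋙ (precomposing _ _ _).obj (F.evalMap f) ⟶
      (SMCFunctor.eval B C a).mapFunctor F G ⋙ (postcomposing _ _ _).obj (G.evalMap f) where
  app η := ((SMCFunctor.trans η).naturality f).hom
  naturality _ _ M := (SMCFunctor.modif M).naturality f

variable (B C) in
/-- An `SMC`-category structure on the bicategory of `SMC`-functors is computed in the target if,
for suitable `SMC`-functor structures on the evaluations,
* evaluation at a 0-cell `b` is strict monoidal on hom-categories, so that `(η ⊕ σ)_b = η_b ⊕ σ_b`,
  the unit has components `𝟎`, and sums and coherence isomorphisms of modifications are formed in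
  the target; as evaluation preserves composition strictly, its being an `SMC`-functor says that
  the distributivity and nullity isomorphisms are formed in the target as well;
* `η ↦ η_f` is monoidal for every 1-cell `f`, i.e. `(η ⊕ σ)_f` is `η_f ⊕ σ_f` composed with the
  distributivity isomorphisms of the target, and similarly for the unit. -/
def SMCFunctor.IsPointwise [SMCCategory (SMCFunctor B C)] : Prop :=
  ∃ _ : ∀ b : B, SMCFunctorStructure (SMCFunctor.eval B C b),
    (∀ (b : B) (F G : SMCFunctor B C),
      IsStrictMonoidal ((SMCFunctor.eval B C b).mapFunctor F G)) ∧
    (∀ (F G : SMCFunctor B C) {a b : B} (f : a ⟶ b),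
      NatTrans.IsMonoidal (SMCFunctor.evalNatTrans F G f))

end Functors

/-! At a 1-cell `f : a ⟶ b`, the 2-cell of a transformation from `F` to `G` is a morphism `S x ⟶ T
y`, where `S = - ∘ F f` and `T = G f ∘ -` are strong monoidal functors and `x`, `y` are the
components at `b` and `a`. Such cells can be added: `tensorCell` is `δ` of `S`, then the tensor
product, then `μ` of `T`, and `unitCell` is its nullary version. Adding cells is functorial
(`tensorCell_comp`), compatible with monoidal functors (`map_tensorCell`), and a monoidal
transformation evaluated at a sum is the sum of its components (`tensorCell_app`).

In an axiom for the transformation `η ⊕ σ`, the 2-cells that do not come from `η ⊕ σ` itself are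
associativity and unit isomorphisms, monoidal by hypothesis, or whiskerings by a 2-cell, monoidal
because the structure maps of the adjoints of composition are natural
(`precomposing_map_isMonoidal`, `postcomposing_map_isMonoidal`). Both sides therefore collapse to a
single sum, whose entries are the two sides of the axioms for `η` and `σ`. Similar calculations show
that the coherence and distributivity isomorphisms are modifications. The sum is monoidal in `f`
because pointwise sums of monoidal transformations with symmetric monoidal target are monoidal, and
because the distributivity isomorphisms of `C` are monoidal.

After that, equality of modifications is tested on components (`hom_ext`), where each remaining
axiom is an axiom of `C`. For strictness, a modification whose components are all of the form
`eqToHom` forces its source and target to be equal and is itself of that form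
(`strongTrans_exists_eq_eqToHom`). -/

/-! ### Sums of cells along monoidal functors. -/

section TensorCells

open scoped MonoidalCategory
open Functor.LaxMonoidal Functor.OplaxMonoidal

variable {D₁ : Type u₁} [Category.{v₁} D₁] [MonoidalCategory D₁]
  {D₂ : Type u₂} [Category.{v₂} D₂] [MonoidalCategory D₂]
  {E : Type u₃} [Category.{v₃} E] [MonoidalCategory E]
  {E' : Type u₄} [Category.{v₄} E'] [MonoidalCategory E']

/-- The sum of two morphisms `S x ⟶ T y` and `S x' ⟶ T y'` along monoidal functors. -/
def tensorCell (S : D₁ ⥤ E) (T : D₂ ⥤ E) [S.Monoidal] [T.Monoidal] {x x' : D₁} {y y' : D₂}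
    (u : S.obj x ⟶ T.obj y) (v : S.obj x' ⟶ T.obj y') : S.obj (x ⊗ x') ⟶ T.obj (y ⊗ y') :=
  δ S x x' ≫ (u ⊗ₘ v) ≫ μ T y y'

/-- The canonical morphism `S (𝟙_) ⟶ T (𝟙_)` for monoidal functors `S` and `T`. -/
def unitCell (S : D₁ ⥤ E) (T : D₂ ⥤ E) [S.Monoidal] [T.Monoidal] :
    S.obj (𝟙_ D₁) ⟶ T.obj (𝟙_ D₂) :=
  η S ≫ Functor.LaxMonoidal.ε T

section

variable {S : D₁ ⥤ E} {T : D₂ ⥤ E} [S.Monoidal] [T.Monoidal]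

/-- The `μ` and `δ` of the middle functor `T` meet and cancel, since `T` is strong. -/
theorem tensorCell_comp {D₃ : Type*} [Category* D₃] [MonoidalCategory D₃] {R : D₃ ⥤ E} [R.Monoidal]
    {x x' : D₁} {y y' : D₂} {z z' : D₃}
    (u : S.obj x ⟶ T.obj y) (v : S.obj x' ⟶ T.obj y')
    (u' : T.obj y ⟶ R.obj z) (v' : T.obj y' ⟶ R.obj z') :
    tensorCell S T u v ≫ tensorCell T R u' v' = tensorCell S R (u ≫ u') (v ≫ v') := by
  simp [tensorCell]

theorem unitCell_comp {D₃ : Type*} [Category* D₃] [MonoidalCategory D₃] {R : D₃ ⥤ E} [R.Monoidal] :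
    unitCell S T ≫ unitCell T R = unitCell S R := by
  simp [unitCell]

theorem tensorCell_id (x x' : D₁) : tensorCell S S (𝟙 (S.obj x)) (𝟙 (S.obj x')) = 𝟙 _ := by
  simp [tensorCell]

theorem unitCell_self : unitCell S S = 𝟙 _ := by
  simp [unitCell]

/-- The sum of two isomorphisms along monoidal functors. -/
@[simps]
def tensorCellIso {x x' : D₁} {y y' : D₂}
    (u : S.obj x ≅ T.obj y) (v : S.obj x' ≅ T.obj y') : S.obj (x ⊗ x') ≅ T.obj (y ⊗ y') where
  hom := tensorCell S T u.hom v.hom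
  inv := tensorCell T S u.inv v.inv
  hom_inv_id := by rw [tensorCell_comp, u.hom_inv_id, v.hom_inv_id, tensorCell_id]
  inv_hom_id := by rw [tensorCell_comp, u.inv_hom_id, v.inv_hom_id, tensorCell_id]

variable (S T) in
/-- The canonical isomorphism `S (𝟙_) ≅ T (𝟙_)`. -/
@[simps]
def unitCellIso : S.obj (𝟙_ D₁) ≅ T.obj (𝟙_ D₂) where
  hom := unitCell S T
  inv := unitCell T S
  hom_inv_id := by rw [unitCell_comp, unitCell_self]
  inv_hom_id := by rw [unitCell_comp, unitCell_self]

theorem map_tensorHom_eq {x x' y y' : D₁} (f : x ⟶ y) (g : x' ⟶ y') :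
    S.map (f ⊗ₘ g) = tensorCell S S (S.map f) (S.map g) := by
  simp [tensorCell]

/-- Precomposing the monoidality square of `α` with `δ S` cancels `μ S`. This turns structural
2-cells at a sum of 1-cells into sums of 2-cells. -/
theorem tensorCell_app {S' : D₁ ⥤ E} [S'.Monoidal] (α : S ⟶ S') (h : NatTrans.IsMonoidal α)
    (x x' : D₁) : α.app (x ⊗ x') = tensorCell S S' (α.app x) (α.app x') := by
  rw [tensorCell, ← h.tensor, Functor.Monoidal.δ_μ_assoc]

theorem unitCell_app {S' : D₁ ⥤ E} [S'.Monoidal] (α : S ⟶ S') (h : NatTrans.IsMonoidal α) :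
    α.app (𝟙_ D₁) = unitCell S S' := by
  rw [unitCell, ← h.unit, Functor.Monoidal.η_ε_assoc]

/-- The constraints of `S ⋙ R` and `T ⋙ R` are those of `R` combined with the images of those of `S`
and `T`; the contributions of `R` cancel by naturality. It serves to whisker a sum of cells by a
1-cell. -/
theorem map_tensorCell (R : E ⥤ E') [R.Monoidal] {x x' : D₁} {y y' : D₂}
    (u : S.obj x ⟶ T.obj y) (v : S.obj x' ⟶ T.obj y') :
    R.map (tensorCell S T u v) = tensorCell (S ⋙ R) (T ⋙ R) (R.map u) (R.map v) := by
  simp [tensorCell]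

theorem map_unitCell (R : E ⥤ E') [R.Monoidal] :
    R.map (unitCell S T) = unitCell (S ⋙ R) (T ⋙ R) := by
  simp [unitCell]

/-- With `P` and `Q` composition with a fixed 1-cell, this is the modification square of a
distributivity isomorphism. -/
theorem tensorCell_map_μ {D₃ : Type*} [Category* D₃] [MonoidalCategory D₃]
    {D₄ : Type*} [Category* D₄] [MonoidalCategory D₄] (P : D₃ ⥤ D₁) (Q : D₄ ⥤ D₂)
    [P.Monoidal] [Q.Monoidal] {x x' : D₃} {y y' : D₄}
    (u : S.obj (P.obj x) ⟶ T.obj (Q.obj y)) (v : S.obj (P.obj x') ⟶ T.obj (Q.obj y')) :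
    tensorCell S T u v ≫ T.map (μ Q y y') =
      S.map (μ P x x') ≫ tensorCell (P ⋙ S) (Q ⋙ T) u v := by
  simp [tensorCell]

theorem unitCell_map_ε {D₃ : Type*} [Category* D₃] [MonoidalCategory D₃]
    {D₄ : Type*} [Category* D₄] [MonoidalCategory D₄] (P : D₃ ⥤ D₁) (Q : D₄ ⥤ D₂)
    [P.Monoidal] [Q.Monoidal] :
    unitCell S T ≫ T.map (Functor.LaxMonoidal.ε Q) =
      S.map (Functor.LaxMonoidal.ε P) ≫ unitCell (P ⋙ S) (Q ⋙ T) := by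
  simp [unitCell]

theorem tensorCell_natural {x x' z z' : D₁} {y y' w w' : D₂}
    {u : S.obj x ⟶ T.obj y} {v : S.obj x' ⟶ T.obj y'}
    {u' : S.obj z ⟶ T.obj w} {v' : S.obj z' ⟶ T.obj w'}
    {f : x ⟶ z} {f' : x' ⟶ z'} {g : y ⟶ w} {g' : y' ⟶ w'}
    (h : S.map f ≫ u' = u ≫ T.map g) (h' : S.map f' ≫ v' = v ≫ T.map g') :
    S.map (f ⊗ₘ f') ≫ tensorCell S T u' v' = tensorCell S T u v ≫ T.map (g ⊗ₘ g') := by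
  rw [map_tensorHom_eq, map_tensorHom_eq, tensorCell_comp, tensorCell_comp, h, h']

theorem tensorCell_associator {x x' x'' : D₁} {y y' y'' : D₂} (u : S.obj x ⟶ T.obj y)
    (v : S.obj x' ⟶ T.obj y') (w : S.obj x'' ⟶ T.obj y'') :
    S.map (α_ x x' x'').hom ≫ tensorCell S T u (tensorCell S T v w) =
      tensorCell S T (tensorCell S T u v) w ≫ T.map (α_ y y' y'').hom := by
  -- The inner constraints are pulled out of the tensor product as whiskerings, the form in which
  -- the associativity axioms of `δ S` and `μ T` apply.
  have hl : (u ⊗ₘ tensorCell S T v w) =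
      S.obj x ◁ δ S x' x'' ≫ (u ⊗ₘ (v ⊗ₘ w)) ≫ T.obj y ◁ μ T y' y'' := by
    simp [tensorCell, MonoidalCategory.tensorHom_comp_whiskerLeft,
      MonoidalCategory.whiskerLeft_comp_tensorHom]
  have hr : (tensorCell S T u v ⊗ₘ w) =
      δ S x x' ▷ S.obj x'' ≫ ((u ⊗ₘ v) ⊗ₘ w) ≫ μ T y y' ▷ T.obj y'' := by
    rw [MonoidalCategory.tensorHom_comp_whiskerRight,
      MonoidalCategory.whiskerRight_comp_tensorHom, tensorCell]
  rw [tensorCell.eq_def S T u, hl, tensorCell.eq_def S T _ w, hr]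
  simp

theorem tensorCell_leftUnitor {x : D₁} {y : D₂} (u : S.obj x ⟶ T.obj y) :
    S.map (MonoidalCategoryStruct.leftUnitor x).hom ≫ u =
      tensorCell S T (unitCell S T) u ≫ T.map (MonoidalCategoryStruct.leftUnitor y).hom := by
  -- Interchange moves the unit constraints to the outside, where the unitality axioms of `S` and
  -- `T` absorb them.
  have h : (unitCell S T ⊗ₘ u) = η S ▷ S.obj x ≫ 𝟙_ E ◁ u ≫ Functor.LaxMonoidal.ε T ▷ T.obj y := by
    rw [unitCell, MonoidalCategory.tensorHom_def, MonoidalCategory.comp_whiskerRight,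
      Category.assoc, MonoidalCategory.whisker_exchange]
  rw [tensorCell, h]
  simp

theorem tensorCell_rightUnitor {x : D₁} {y : D₂} (u : S.obj x ⟶ T.obj y) :
    S.map (MonoidalCategoryStruct.rightUnitor x).hom ≫ u =
      tensorCell S T u (unitCell S T) ≫ T.map (MonoidalCategoryStruct.rightUnitor y).hom := by
  have h : (u ⊗ₘ unitCell S T) = S.obj x ◁ η S ≫ u ▷ 𝟙_ E ≫ T.obj y ◁ Functor.LaxMonoidal.ε T := by
    rw [unitCell, MonoidalCategory.tensorHom_def', MonoidalCategory.whiskerLeft_comp,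
      Category.assoc, ← MonoidalCategory.whisker_exchange]
  rw [tensorCell, h]
  simp

end

theorem tensorCell_braiding [BraidedCategory D₁] [BraidedCategory D₂] [BraidedCategory E]
    {S : D₁ ⥤ E} {T : D₂ ⥤ E} [S.Braided] [T.Braided] {x x' : D₁} {y y' : D₂}
    (u : S.obj x ⟶ T.obj y) (v : S.obj x' ⟶ T.obj y') :
    S.map (β_ x x').hom ≫ tensorCell S T v u = tensorCell S T u v ≫ T.map (β_ y y').hom := by
  simp [tensorCell, Functor.map_braiding]

end TensorCells

/-! ### Monoidal transformations and pointwise sums of functors. -/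

section MonoidalTransformations

open scoped MonoidalCategory
open Functor.LaxMonoidal Functor.OplaxMonoidal

variable {C : Type u₁} [Category.{v₁} C] [MonoidalCategory C]
  {D : Type u₂} [Category.{v₂} D] [MonoidalCategory D]
  {E : Type u₃} [Category.{v₃} E] [MonoidalCategory E]

theorem isMonoidal_inv {F G : C ⥤ D} [F.LaxMonoidal] [G.LaxMonoidal] (e : F ≅ G)
    (_ : NatTrans.IsMonoidal e.hom) : NatTrans.IsMonoidal e.inv :=
  inferInstance

theorem isMonoidal_of_hom_inv_id {F G : C ⥤ D} [F.LaxMonoidal] [G.LaxMonoidal] {σ : F ⟶ G}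
    {τ : G ⟶ F} (h : NatTrans.IsMonoidal σ) (hστ : σ ≫ τ = 𝟙 F) (hτσ : τ ≫ σ = 𝟙 G) :
    NatTrans.IsMonoidal τ :=
  isMonoidal_inv ⟨σ, τ, hστ, hτσ⟩ h

variable [BraidedCategory D] [BraidedCategory E]

/-- The pointwise sum is the pairing of `σ` and `τ` whiskered with the tensor functor, which is
monoidal thanks to the braiding. -/
theorem isMonoidal_tensorHom {P P' Q Q' : C ⥤ D} [P.Monoidal] [P'.Monoidal] [Q.Monoidal]
    [Q'.Monoidal] {σ : P ⟶ P'} {τ : Q ⟶ Q'} (hσ : NatTrans.IsMonoidal σ)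
    (hτ : NatTrans.IsMonoidal τ) : NatTrans.IsMonoidal (σ ⊗ₘ τ) :=
  (inferInstance :
    NatTrans.IsMonoidal (Functor.whiskerRight (NatTrans.prod' σ τ) (MonoidalCategory.tensor D)))

/-- Precomposition with a functor preserves the constant functor at the unit. -/
def unitCompIso (M : C ⥤ D) : M ⋙ 𝟙_ (D ⥤ E) ≅ 𝟙_ (C ⥤ E) :=
  Iso.refl _

/-- Precomposition with a functor is compatible with pointwise tensor products. -/
def compTensorIso (M : C ⥤ D) (P Q : D ⥤ E) : M ⋙ (P ⊗ Q) ≅ (M ⋙ P) ⊗ (M ⋙ Q) :=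
  Iso.refl _

theorem ε_tensor (P Q : C ⥤ D) [P.Monoidal] [Q.Monoidal] :
    Functor.LaxMonoidal.ε (P ⊗ Q) = (MonoidalCategoryStruct.leftUnitor _).inv ≫
      (Functor.LaxMonoidal.ε P ⊗ₘ Functor.LaxMonoidal.ε Q) := by
  change Functor.LaxMonoidal.ε (MonoidalCategory.tensor D) ≫
    (MonoidalCategory.tensor D).map (Functor.LaxMonoidal.ε (P.prod' Q)) = _
  simp

theorem μ_tensor (P Q : C ⥤ D) [P.Monoidal] [Q.Monoidal] (x y : C) :
    μ (P ⊗ Q) x y = MonoidalCategory.tensorμ _ _ _ _ ≫ (μ P x y ⊗ₘ μ Q x y) := by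
  change μ (MonoidalCategory.tensor D) _ _ ≫
    (MonoidalCategory.tensor D).map (μ (P.prod' Q) x y) = _
  simp

-- The components are identities, so the content is that two monoidal structures, assembled in
-- different orders, agree.
omit [BraidedCategory D] in
theorem compTensorIso_isMonoidal (M : C ⥤ D) (P Q : D ⥤ E) [M.Monoidal] [P.Monoidal]
    [Q.Monoidal] : NatTrans.IsMonoidal (compTensorIso M P Q).hom where
  unit := by
    simp [compTensorIso, ε_tensor]
  tensor X Y := by
    simp [compTensorIso, μ_tensor]

omit [BraidedCategory D] [BraidedCategory E] in
theorem unitCompIso_isMonoidal (M : C ⥤ D) [M.Monoidal] :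
    NatTrans.IsMonoidal (unitCompIso (E := E) M).hom where
  unit := by
    change (𝟙 _ ≫ 𝟙 _) ≫ 𝟙 (𝟙_ E) = 𝟙 _
    simp
  tensor _ _ := by
    change ((MonoidalCategoryStruct.leftUnitor (𝟙_ E)).hom ≫ 𝟙 _) ≫ 𝟙 (𝟙_ E) =
      (𝟙 _ ⊗ₘ 𝟙 _) ≫ (MonoidalCategoryStruct.leftUnitor (𝟙_ E)).hom
    simp

end MonoidalTransformations

/-! ### Squares and triangles of cells, the shapes of the naturality and unit axioms. -/

section TensorCellSquares

open scoped MonoidalCategory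

variable {D₁ : Type u₁} [Category.{v₁} D₁] [MonoidalCategory D₁]
  {D₂ : Type u₂} [Category.{v₂} D₂] [MonoidalCategory D₂]
  {E : Type u₃} [Category.{v₃} E] [MonoidalCategory E]

theorem tensorCell_square {S S' : D₁ ⥤ E} {T T' : D₂ ⥤ E} [S.Monoidal] [S'.Monoidal] [T.Monoidal]
    [T'.Monoidal] {α : S ⟶ S'} {β : T ⟶ T'} (hα : NatTrans.IsMonoidal α)
    (hβ : NatTrans.IsMonoidal β) {x x' : D₁} {y y' : D₂}
    {u : S.obj x ⟶ T.obj y} {v : S.obj x' ⟶ T.obj y'}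
    {u' : S'.obj x ⟶ T'.obj y} {v' : S'.obj x' ⟶ T'.obj y'}
    (h : α.app x ≫ u' = u ≫ β.app y) (h' : α.app x' ≫ v' = v ≫ β.app y') :
    α.app (x ⊗ x') ≫ tensorCell S' T' u' v' = tensorCell S T u v ≫ β.app (y ⊗ y') := by
  rw [tensorCell_app α hα, tensorCell_app β hβ, tensorCell_comp, tensorCell_comp, h, h']

theorem unitCell_square {S S' : D₁ ⥤ E} {T T' : D₂ ⥤ E} [S.Monoidal] [S'.Monoidal] [T.Monoidal]
    [T'.Monoidal] {α : S ⟶ S'} {β : T ⟶ T'} (hα : NatTrans.IsMonoidal α)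
    (hβ : NatTrans.IsMonoidal β) :
    α.app (𝟙_ D₁) ≫ unitCell S' T' = unitCell S T ≫ β.app (𝟙_ D₂) := by
  rw [unitCell_app α hα, unitCell_app β hβ, unitCell_comp, unitCell_comp]

theorem tensorCell_triangle {S T T' : D₁ ⥤ E} [S.Monoidal] [T.Monoidal]
    [T'.Monoidal] {α : S ⟶ T'} {β : T ⟶ T'} (hα : NatTrans.IsMonoidal α)
    (hβ : NatTrans.IsMonoidal β) {x x' : D₁}
    {u : S.obj x ⟶ T.obj x} {v : S.obj x' ⟶ T.obj x'}
    (h : u ≫ β.app x = α.app x) (h' : v ≫ β.app x' = α.app x') :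
    tensorCell S T u v ≫ β.app (x ⊗ x') = α.app (x ⊗ x') := by
  rw [tensorCell_app α hα, tensorCell_app β hβ, tensorCell_comp, h, h']

theorem unitCell_triangle {S T T' : D₁ ⥤ E} [S.Monoidal] [T.Monoidal]
    [T'.Monoidal] {α : S ⟶ T'} {β : T ⟶ T'} (hα : NatTrans.IsMonoidal α)
    (hβ : NatTrans.IsMonoidal β) :
    unitCell S T ≫ β.app (𝟙_ D₁) = α.app (𝟙_ D₁) := by
  rw [unitCell_app α hα, unitCell_app β hβ, unitCell_comp]

end TensorCellSquares

/-! ### Whiskering in an `SMC`-category. -/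

section SMCCategory

open scoped MonoidalCategory
open Functor.LaxMonoidal Functor.OplaxMonoidal

variable {B : Type u₁} [Bicategory.{w₁, v₁} B] [SMCCategory B]

/-- The structure on `- ∘ f` is induced through evaluation at `f`, whose own constraints are
identities. -/
theorem precomp_μ {a b c : B} (f : a ⟶ b) (g g' : b ⟶ c) :
    μ ((precomposing a b c).obj f) g g' = (μ (postcomposing a b c) g g').app f :=
  Category.id_comp ((μ (postcomposing a b c) g g').app f)

theorem precomp_δ {a b c : B} (f : a ⟶ b) (g g' : b ⟶ c) :
    δ ((precomposing a b c).obj f) g g' = (δ (postcomposing a b c) g g').app f :=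
  Category.comp_id ((δ (postcomposing a b c) g g').app f)

theorem precomp_ε {a b c : B} (f : a ⟶ b) :
    Functor.LaxMonoidal.ε ((precomposing a b c).obj f) =
      (Functor.LaxMonoidal.ε (postcomposing a b c)).app f :=
  Category.id_comp ((Functor.LaxMonoidal.ε (postcomposing a b c)).app f)

theorem precomp_η {a b c : B} (f : a ⟶ b) :
    η ((precomposing a b c).obj f) = (η (postcomposing a b c)).app f :=
  Category.comp_id ((η (postcomposing a b c)).app f)

theorem postcomp_μ {a b c : B} (g : b ⟶ c) (f f' : a ⟶ b) :
    μ ((postcomposing a b c).obj g) f f' = (μ (precomposing a b c) f f').app g :=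
  Category.id_comp ((μ (precomposing a b c) f f').app g)

theorem postcomp_ε {a b c : B} (g : b ⟶ c) :
    Functor.LaxMonoidal.ε ((postcomposing a b c).obj g) =
      (Functor.LaxMonoidal.ε (precomposing a b c)).app g :=
  Category.id_comp ((Functor.LaxMonoidal.ε (precomposing a b c)).app g)

/-- The constraints of `- ∘ f` are components at `f` of the constraints of `postcomposing a b c`;
these are natural transformations, and the claim is their naturality at `β`. -/
theorem precomposing_map_isMonoidal {a b : B} {f f' : a ⟶ b} (β : f ⟶ f') (c : B) :
    NatTrans.IsMonoidal ((precomposing a b c).map β) where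
  unit := by
    rw [precomp_ε, precomp_ε]
    exact ((Functor.LaxMonoidal.ε (postcomposing a b c)).naturality β).symm.trans
      (Category.id_comp _)
  tensor g g' := by
    rw [precomp_μ, precomp_μ]
    exact ((μ (postcomposing a b c) g g').naturality β).symm

theorem postcomposing_map_isMonoidal (a : B) {b c : B} {g g' : b ⟶ c} (β : g ⟶ g') :
    NatTrans.IsMonoidal ((postcomposing a b c).map β) where
  unit := by
    rw [postcomp_ε, postcomp_ε]
    exact ((Functor.LaxMonoidal.ε (precomposing a b c)).naturality β).symm.trans
      (Category.id_comp _)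
  tensor f f' := by
    rw [postcomp_μ, postcomp_μ]
    exact ((μ (precomposing a b c) f f').naturality β).symm

theorem postcomposing_δ_isMonoidal {a b c : B} (g g' : b ⟶ c) :
    NatTrans.IsMonoidal (δ (postcomposing a b c) g g') :=
  isMonoidal_of_hom_inv_id (SMCCategory.postcomposing_μ g g') (Functor.Monoidal.μ_δ _ _ _)
    (Functor.Monoidal.δ_μ _ _ _)

theorem postcomposing_η_isMonoidal (a b c : B) :
    NatTrans.IsMonoidal (η (postcomposing a b c)) :=
  isMonoidal_of_hom_inv_id (SMCCategory.postcomposing_ε a b c) (Functor.Monoidal.ε_η _)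
    (Functor.Monoidal.η_ε _)

/-- This is the component at `g` of the braiding condition on `f ↦ - ∘ f`. -/
instance postcompBraided {a b c : B} (g : b ⟶ c) : ((postcomposing a b c).obj g).Braided where
  braided f f' := by
    rw [postcomp_μ, postcomp_μ]
    exact congrArg (fun τ => τ.app g) (Functor.LaxBraided.braided (F := precomposing a b c) f f')

instance precompBraided {a b c : B} (f : a ⟶ b) : ((precomposing a b c).obj f).Braided where
  braided g g' := by
    rw [precomp_μ, precomp_μ]
    exact congrArg (fun τ => τ.app f) (Functor.LaxBraided.braided (F := postcomposing a b c) g g')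

end SMCCategory

/-! ### Pointwise sums of strong transformations. -/

namespace StrongTransSum

open scoped MonoidalCategory
open Functor.LaxMonoidal Functor.OplaxMonoidal

variable {B : Type u₁} [Bicategory.{w₁, v₁} B] {C : Type u₂} [Bicategory.{w₂, v₂} C]
  [SMCCategory C] {F G H : B ⥤ᵖ C}

/-- The pointwise sum of strong transformations. -/
def sum (η σ : F ⟶ G) : F ⟶ G where
  app b := η.app b ⊗ σ.app b
  naturality {a b} f :=
    tensorCellIso (S := (precomposing _ _ (G.obj b)).obj (F.map f))
      (T := (postcomposing (F.obj a) _ _).obj (G.map f)) (η.naturality f) (σ.naturality f)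
  naturality_naturality {a b f g} β :=
    tensorCell_square (precomposing_map_isMonoidal (F.map₂ β) _)
      (postcomposing_map_isMonoidal _ (G.map₂ β))
      (η.naturality_naturality β) (σ.naturality_naturality β)
  naturality_id a :=
    tensorCell_triangle
      -- The 2-cells of the unit axiom not coming from the transformation itself are grouped into
      -- one monoidal transformation, evaluated at the component at `a`.
      (α := (precomposing _ _ _).map (F.mapId a).hom ≫ (leftUnitorNatIso _ _).hom ≫
        (rightUnitorNatIso _ _).inv)
      (isMonoidal_comp (precomposing_map_isMonoidal _ _) inferInstance)
      (postcomposing_map_isMonoidal _ (G.mapId a).hom) (η.naturality_id a) (σ.naturality_id a)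
  naturality_comp {a b c} f g := by
    -- Each factor is exhibited as a monoidal transformation at a sum, or as a monoidal functor
    -- applied to a `tensorCell`, so that all factors become sums of cells and merge into one.
    change tensorCell _ _ _ _ ≫ ((postcomposing _ _ _).map (G.mapComp f g).hom).app _ =
      ((precomposing _ _ _).map (F.mapComp f g).hom).app _ ≫
      (associatorNatIsoRight (F.map f) (F.map g) _).hom.app _ ≫
      ((precomposing _ _ _).obj (F.map f)).map (tensorCell _ _ _ _) ≫
      (associatorNatIsoMiddle (F.map f) (G.map g)).inv.app _ ≫
      ((postcomposing _ _ _).obj (G.map g)).map (tensorCell _ _ _ _) ≫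
      (associatorNatIsoLeft _ (G.map f) (G.map g)).hom.app _
    rw [tensorCell_app _ (postcomposing_map_isMonoidal _ (G.mapComp f g).hom),
      tensorCell_app _ (precomposing_map_isMonoidal (F.mapComp f g).hom _),
      tensorCell_app _ (SMCCategory.associator_right _ _ _),
      tensorCell_app (associatorNatIsoLeft _ (G.map f) (G.map g)).hom
        (SMCCategory.associator_left _ _ _),
      tensorCell_app (associatorNatIsoMiddle (F.map f) (G.map g)).inv inferInstance,
      map_tensorCell, map_tensorCell]
    simp only [tensorCell_comp]
    exact congrArg₂ _ (η.naturality_comp f g) (σ.naturality_comp f g)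

variable (F G) in
/-- The strong transformation with components the units. -/
def zero : F ⟶ G where
  app b := 𝟙_ _
  naturality {a b} f :=
    unitCellIso ((precomposing _ _ (G.obj b)).obj (F.map f))
      ((postcomposing (F.obj a) _ _).obj (G.map f))
  naturality_naturality {a b f g} β :=
    unitCell_square (precomposing_map_isMonoidal (F.map₂ β) _)
      (postcomposing_map_isMonoidal _ (G.map₂ β))
  naturality_id a :=
    unitCell_triangle
      (α := (precomposing _ _ _).map (F.mapId a).hom ≫ (leftUnitorNatIso _ _).hom ≫
        (rightUnitorNatIso _ _).inv)
      (isMonoidal_comp (precomposing_map_isMonoidal _ _) inferInstance)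
      (postcomposing_map_isMonoidal _ (G.mapId a).hom)
  naturality_comp {a b c} f g := by
    change unitCell _ _ ≫ ((postcomposing _ _ _).map (G.mapComp f g).hom).app _ =
      ((precomposing _ _ _).map (F.mapComp f g).hom).app _ ≫
      (associatorNatIsoRight (F.map f) (F.map g) _).hom.app _ ≫
      ((precomposing _ _ _).obj (F.map f)).map (unitCell _ _) ≫
      (associatorNatIsoMiddle (F.map f) (G.map g)).inv.app _ ≫
      ((postcomposing _ _ _).obj (G.map g)).map (unitCell _ _) ≫
      (associatorNatIsoLeft _ (G.map f) (G.map g)).hom.app _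
    rw [unitCell_app _ (postcomposing_map_isMonoidal _ (G.mapComp f g).hom),
      unitCell_app _ (precomposing_map_isMonoidal (F.mapComp f g).hom _),
      unitCell_app _ (SMCCategory.associator_right _ _ _),
      unitCell_app (associatorNatIsoLeft _ (G.map f) (G.map g)).hom
        (SMCCategory.associator_left _ _ _),
      unitCell_app (associatorNatIsoMiddle (F.map f) (G.map g)).inv inferInstance,
      map_unitCell, map_unitCell]
    -- Composites of unit cells depend only on the outer functors, so both sides are the same unit
    -- cell.
    simp only [unitCell_comp]

end StrongTransSum

/-! ### Sums of modifications, coherence and distributivity modifications. -/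

namespace StrongTransSum

open scoped MonoidalCategory
open Functor.LaxMonoidal Functor.OplaxMonoidal

variable {B : Type u₁} [Bicategory.{w₁, v₁} B] {C : Type u₂} [Bicategory.{w₂, v₂} C]
  [SMCCategory C] {F G H : B ⥤ᵖ C}

omit [SMCCategory C] in
theorem comp_naturality_hom (η : F ⟶ G) (θ : G ⟶ H) {a b : B} (f : a ⟶ b) :
    ((η ≫ θ).naturality f).hom = (α_ (F.map f) (η.app b) (θ.app b)).inv ≫
      (η.naturality f).hom ▷ θ.app b ≫ (α_ (η.app a) (G.map f) (θ.app b)).hom ≫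
        η.app a ◁ (θ.naturality f).hom ≫ (α_ (η.app a) (θ.app a) (H.map f)).inv := by
  exact Pseudofunctor.StrongTrans.categoryStruct_comp_naturality_hom (C := C) η θ f

/-- The sum of modifications. -/
def sumMap {η η' σ σ' : F ⟶ G} (M : η ⟶ η') (N : σ ⟶ σ') : sum η σ ⟶ sum η' σ' where
  as :=
    { app b := M.as.app b ⊗ₘ N.as.app b
      naturality f := tensorCell_natural
        (S := (precomposing _ _ _).obj (F.map f)) (T := (postcomposing _ _ _).obj (G.map f))
        (M.as.naturality f) (N.as.naturality f) }

/-- The sum of a strong transformation and a modification. -/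
def sumWhiskerLeft (η : F ⟶ G) {σ σ' : F ⟶ G} (N : σ ⟶ σ') : sum η σ ⟶ sum η σ' where
  as :=
    { app b := MonoidalCategoryStruct.whiskerLeft (η.app b) (N.as.app b)
      naturality f := by
        rw [← MonoidalCategory.id_tensorHom, ← MonoidalCategory.id_tensorHom]
        exact (sumMap (𝟙 η) N).as.naturality f }

/-- The sum of a modification and a strong transformation. -/
def sumWhiskerRight {η η' : F ⟶ G} (M : η ⟶ η') (σ : F ⟶ G) : sum η σ ⟶ sum η' σ where
  as :=
    { app b := MonoidalCategoryStruct.whiskerRight (M.as.app b) (σ.app b)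
      naturality f := by
        rw [← MonoidalCategory.tensorHom_id, ← MonoidalCategory.tensorHom_id]
        exact (sumMap M (𝟙 σ)).as.naturality f }

/-- The associator of the sum of strong transformations. -/
def sumAssociator (η σ τ : F ⟶ G) : sum (sum η σ) τ ≅ sum η (sum σ τ) :=
  Pseudofunctor.StrongTrans.isoMk
    (fun b => MonoidalCategoryStruct.associator (η.app b) (σ.app b) (τ.app b))
    (fun f => tensorCell_associator (S := (precomposing _ _ _).obj (F.map f)) (T := (postcomposing _ _ _).obj (G.map f))
      (η.naturality f).hom (σ.naturality f).hom (τ.naturality f).hom)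

/-- The left unitor of the sum of strong transformations. -/
def sumLeftUnitor (η : F ⟶ G) : sum (zero F G) η ≅ η :=
  Pseudofunctor.StrongTrans.isoMk (fun b => MonoidalCategoryStruct.leftUnitor (η.app b))
    (fun f => tensorCell_leftUnitor (S := (precomposing _ _ _).obj (F.map f)) (T := (postcomposing _ _ _).obj (G.map f))
      (η.naturality f).hom)

/-- The right unitor of the sum of strong transformations. -/
def sumRightUnitor (η : F ⟶ G) : sum η (zero F G) ≅ η :=
  Pseudofunctor.StrongTrans.isoMk (fun b => MonoidalCategoryStruct.rightUnitor (η.app b))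
    (fun f => tensorCell_rightUnitor (S := (precomposing _ _ _).obj (F.map f)) (T := (postcomposing _ _ _).obj (G.map f))
      (η.naturality f).hom)

/-- The symmetry of the sum of strong transformations. -/
def sumBraiding (η σ : F ⟶ G) : sum η σ ≅ sum σ η :=
  Pseudofunctor.StrongTrans.isoMk (fun b => β_ (η.app b) (σ.app b))
    (fun f => tensorCell_braiding (S := (precomposing _ _ _).obj (F.map f)) (T := (postcomposing _ _ _).obj (G.map f))
      (η.naturality f).hom (σ.naturality f).hom)

/-- With `η` fixed, every factor of the pasting is monoidal in the component of the second
transformation, so the composite cell is a sum along the two composite functors. This identifies one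
side of the modification square of `compSum`. -/
theorem comp_sum_naturality (η : F ⟶ G) (θ θ' : G ⟶ H) {a b : B} (f : a ⟶ b) :
    tensorCell ((precomposing _ _ _).obj (η.app b) ⋙ (precomposing _ _ _).obj (F.map f))
      ((precomposing _ _ _).obj (η.app a) ⋙ (postcomposing _ _ _).obj (H.map f))
      ((η ≫ θ).naturality f).hom ((η ≫ θ').naturality f).hom =
      ((η ≫ sum θ θ').naturality f).hom := by
  refine Eq.trans ?_ (comp_naturality_hom η (sum θ θ') f).symm
  change _ = (associatorNatIsoRight (F.map f) (η.app b) _).inv.app (θ.app b ⊗ θ'.app b) ≫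
    ((precomposing _ _ _).map (η.naturality f).hom).app (θ.app b ⊗ θ'.app b) ≫
    (associatorNatIsoRight (η.app a) (G.map f) _).hom.app (θ.app b ⊗ θ'.app b) ≫
    ((precomposing _ _ _).obj (η.app a)).map (tensorCell _ _ _ _) ≫
    (associatorNatIsoMiddle (η.app a) (H.map f)).inv.app (θ.app a ⊗ θ'.app a)
  rw [tensorCell_app (associatorNatIsoRight (F.map f) (η.app b) _).inv inferInstance,
    tensorCell_app _ (precomposing_map_isMonoidal (η.naturality f).hom _),
    tensorCell_app _ (SMCCategory.associator_right _ _ _),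
    tensorCell_app (associatorNatIsoMiddle (η.app a) (H.map f)).inv inferInstance,
    map_tensorCell]
  simp only [tensorCell_comp]
  exact congrArg₂ _ (comp_naturality_hom η θ f) (comp_naturality_hom η θ' f)

theorem comp_zero_naturality (η : F ⟶ G) {a b : B} (f : a ⟶ b) :
    unitCell ((precomposing _ _ _).obj (η.app b) ⋙ (precomposing _ _ _).obj (F.map f))
      ((precomposing _ _ _).obj (η.app a) ⋙ (postcomposing _ _ _).obj (H.map f)) =
      ((η ≫ zero G H).naturality f).hom := by
  refine Eq.trans ?_ (comp_naturality_hom η (zero G H) f).symm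
  change _ = (associatorNatIsoRight (F.map f) (η.app b) _).inv.app _ ≫
    ((precomposing _ _ _).map (η.naturality f).hom).app _ ≫
    (associatorNatIsoRight (η.app a) (G.map f) _).hom.app _ ≫
    ((precomposing _ _ _).obj (η.app a)).map (unitCell _ _) ≫
    (associatorNatIsoMiddle (η.app a) (H.map f)).inv.app _
  rw [unitCell_app (associatorNatIsoRight (F.map f) (η.app b) _).inv inferInstance,
    unitCell_app _ (precomposing_map_isMonoidal (η.naturality f).hom _),
    unitCell_app _ (SMCCategory.associator_right _ _ _),
    unitCell_app (associatorNatIsoMiddle (η.app a) (H.map f)).inv inferInstance,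
    map_unitCell]
  simp only [unitCell_comp]

/-- The same with `θ` fixed; now the whiskering by the 2-cell of `θ` at `f` is monoidal in the
component of the first transformation. -/
theorem sum_comp_naturality (η η' : F ⟶ G) (θ : G ⟶ H) {a b : B} (f : a ⟶ b) :
    tensorCell ((postcomposing _ _ _).obj (θ.app b) ⋙ (precomposing _ _ _).obj (F.map f))
      ((postcomposing _ _ _).obj (θ.app a) ⋙ (postcomposing _ _ _).obj (H.map f))
      ((η ≫ θ).naturality f).hom ((η' ≫ θ).naturality f).hom =
      ((sum η η' ≫ θ).naturality f).hom := by
  refine Eq.trans ?_ (comp_naturality_hom (sum η η') θ f).symm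
  change _ = (associatorNatIsoMiddle (F.map f) (θ.app b)).inv.app (η.app b ⊗ η'.app b) ≫
    ((postcomposing _ _ _).obj (θ.app b)).map (tensorCell _ _ _ _) ≫
    (associatorNatIsoLeft _ (G.map f) (θ.app b)).hom.app (η.app a ⊗ η'.app a) ≫
    ((postcomposing _ _ _).map (θ.naturality f).hom).app (η.app a ⊗ η'.app a) ≫
    (associatorNatIsoLeft _ (θ.app a) (H.map f)).inv.app (η.app a ⊗ η'.app a)
  rw [tensorCell_app (associatorNatIsoMiddle (F.map f) (θ.app b)).inv inferInstance,
    tensorCell_app _ (postcomposing_map_isMonoidal _ (θ.naturality f).hom),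
    tensorCell_app _ (SMCCategory.associator_left _ _ _),
    tensorCell_app (associatorNatIsoLeft _ (θ.app a) (H.map f)).inv inferInstance,
    map_tensorCell]
  simp only [tensorCell_comp]
  exact congrArg₂ _ (comp_naturality_hom η θ f) (comp_naturality_hom η' θ f)

theorem zero_comp_naturality (θ : G ⟶ H) {a b : B} (f : a ⟶ b) :
    unitCell ((postcomposing _ _ _).obj (θ.app b) ⋙ (precomposing _ _ _).obj (F.map f))
      ((postcomposing _ _ _).obj (θ.app a) ⋙ (postcomposing _ _ _).obj (H.map f)) =
      ((zero F G ≫ θ).naturality f).hom := by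
  refine Eq.trans ?_ (comp_naturality_hom (zero F G) θ f).symm
  change _ = (associatorNatIsoMiddle (F.map f) (θ.app b)).inv.app _ ≫
    ((postcomposing _ _ _).obj (θ.app b)).map (unitCell _ _) ≫
    (associatorNatIsoLeft _ (G.map f) (θ.app b)).hom.app _ ≫
    ((postcomposing _ _ _).map (θ.naturality f).hom).app _ ≫
    (associatorNatIsoLeft _ (θ.app a) (H.map f)).inv.app _
  rw [unitCell_app (associatorNatIsoMiddle (F.map f) (θ.app b)).inv inferInstance,
    unitCell_app _ (postcomposing_map_isMonoidal _ (θ.naturality f).hom),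
    unitCell_app _ (SMCCategory.associator_left _ _ _),
    unitCell_app (associatorNatIsoLeft _ (θ.app a) (H.map f)).inv inferInstance,
    map_unitCell]
  simp only [unitCell_comp]

/-- The distributivity isomorphism `(θ ∘ η) ⊕ (θ' ∘ η) ≅ (θ ⊕ θ') ∘ η`. -/
def compSum (η : F ⟶ G) (θ θ' : G ⟶ H) : sum (η ≫ θ) (η ≫ θ') ≅ η ≫ sum θ θ' :=
  Pseudofunctor.StrongTrans.isoMk
    (fun b => (Functor.Monoidal.μIso (postcomposing _ _ _) (θ.app b) (θ'.app b)).app (η.app b))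
    (fun {a b} f => by
      have h := tensorCell_map_μ (S := (precomposing _ _ _).obj (F.map f))
        (T := (postcomposing _ _ _).obj (H.map f)) (x := θ.app b) (x' := θ'.app b) (y := θ.app a)
        (y' := θ'.app a) ((precomposing _ _ _).obj (η.app b))
        ((precomposing _ _ _).obj (η.app a)) ((η ≫ θ).naturality f).hom ((η ≫ θ').naturality f).hom
      -- The constraints of `- ∘ η_b` and `- ∘ η_a` occurring in `h` are the components of `μ` of
      -- `postcomposing` that define the isomorphism.
      rw [precomp_μ, precomp_μ] at h
      exact (congrArg (_ ≫ ·) (comp_sum_naturality η θ θ' f).symm).trans h.symm)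

/-- The distributivity isomorphism `(θ ∘ η) ⊕ (θ ∘ η') ≅ θ ∘ (η ⊕ η')`. -/
def sumComp (η η' : F ⟶ G) (θ : G ⟶ H) : sum (η ≫ θ) (η' ≫ θ) ≅ sum η η' ≫ θ :=
  Pseudofunctor.StrongTrans.isoMk
    (fun b => (Functor.Monoidal.μIso (precomposing _ _ _) (η.app b) (η'.app b)).app (θ.app b))
    (fun {a b} f => by
      have h := tensorCell_map_μ (S := (precomposing _ _ _).obj (F.map f))
        (T := (postcomposing _ _ _).obj (H.map f)) (x := η.app b) (x' := η'.app b) (y := η.app a)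
        (y' := η'.app a) ((postcomposing _ _ _).obj (θ.app b))
        ((postcomposing _ _ _).obj (θ.app a)) ((η ≫ θ).naturality f).hom ((η' ≫ θ).naturality f).hom
      rw [postcomp_μ, postcomp_μ] at h
      exact (congrArg (_ ≫ ·) (sum_comp_naturality η η' θ f).symm).trans h.symm)

variable (H) in
/-- The nullity isomorphism `𝟎 ≅ 𝟎 ∘ η`. -/
def compZero (η : F ⟶ G) : zero F H ≅ η ≫ zero G H :=
  Pseudofunctor.StrongTrans.isoMk
    (fun b => (Functor.Monoidal.εIso (postcomposing _ _ _)).app (η.app b))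
    (fun {a b} f => by
      have h := unitCell_map_ε (S := (precomposing _ _ _).obj (F.map f))
        (T := (postcomposing _ _ _).obj (H.map f)) ((precomposing _ _ _).obj (η.app b))
        ((precomposing _ _ _).obj (η.app a))
      rw [precomp_ε, precomp_ε] at h
      exact (congrArg (_ ≫ ·) (comp_zero_naturality η f).symm).trans h.symm)

variable (F) in
/-- The nullity isomorphism `𝟎 ≅ θ ∘ 𝟎`. -/
def zeroComp (θ : G ⟶ H) : zero F H ≅ zero F G ≫ θ :=
  Pseudofunctor.StrongTrans.isoMk
    (fun b => (Functor.Monoidal.εIso (precomposing _ _ _)).app (θ.app b))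
    (fun {a b} f => by
      have h := unitCell_map_ε (S := (precomposing _ _ _).obj (F.map f))
        (T := (postcomposing _ _ _).obj (H.map f)) ((postcomposing _ _ _).obj (θ.app b))
        ((postcomposing _ _ _).obj (θ.app a))
      rw [postcomp_ε, postcomp_ε] at h
      exact (congrArg (_ ≫ ·) (zero_comp_naturality θ f).symm).trans h.symm)

end StrongTransSum

/-! ### Monoidality of the pointwise sum. -/

namespace MonoidalTrans

open scoped MonoidalCategory
open Functor.LaxMonoidal Functor.OplaxMonoidal

variable {B : Type u₁} [Bicategory.{w₁, v₁} B] {C : Type u₂} [Bicategory.{w₂, v₂} C]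
  [SMCCategory B] [SMCCategory C] {F G : SMCFunctor B C}

/-- The pointwise sum of monoidal transformations. -/
def sum (η σ : MonoidalTrans F G) : MonoidalTrans F G where
  toTrans := StrongTransSum.sum η.toTrans σ.toTrans
  isMonoidal a b := by
    -- As a transformation in `f`, the cell of the sum is `δ` of `postcomposing`, then the pointwise
    -- tensor of the cells of `η` and `σ`, then `μ` of `precomposing`. The outer factors are
    -- monoidal by the distributivity axioms of `C`.
    have h₁ : NatTrans.IsMonoidal (Functor.whiskerLeft (F.toPseudofunctor.mapFunctor a b)
        (δ (postcomposing _ _ _) (η.toTrans.app b) (σ.toTrans.app b))) :=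
      have := postcomposing_δ_isMonoidal (a := F.toPseudofunctor.obj a) (η.toTrans.app b)
        (σ.toTrans.app b)
      inferInstance
    have h₂ : NatTrans.IsMonoidal (Functor.whiskerLeft (G.toPseudofunctor.mapFunctor a b)
        (μ (precomposing _ _ _) (η.toTrans.app a) (σ.toTrans.app a))) := inferInstance
    have h := isMonoidal_comp h₁ <| isMonoidal_comp (compTensorIso_isMonoidal _ _ _) <|
      isMonoidal_comp (isMonoidal_tensorHom (η.isMonoidal a b) (σ.isMonoidal a b)) <|
      isMonoidal_comp (isMonoidal_inv _ (compTensorIso_isMonoidal _ _ _)) h₂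
    refine Eq.mp (congrArg (fun τ => NatTrans.IsMonoidal τ) ?_) h
    ext f
    refine Eq.trans ?_ (congrArg₂ (fun u v => u ≫ (_ ⊗ₘ _) ≫ v) (precomp_δ _ _ _).symm
      (postcomp_μ _ _ _).symm)
    exact congrArg (_ ≫ ·) ((Category.id_comp _).trans (congrArg (_ ≫ ·) (Category.id_comp _)))

/-- The monoidal transformation with components the units. -/
def zero (F G : SMCFunctor B C) : MonoidalTrans F G where
  toTrans := StrongTransSum.zero F.toPseudofunctor G.toPseudofunctor
  isMonoidal a b := by
    have h₁ : NatTrans.IsMonoidal (Functor.whiskerLeft (F.toPseudofunctor.mapFunctor a b)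
        (η (postcomposing _ (F.toPseudofunctor.obj b) (G.toPseudofunctor.obj b)))) :=
      have := postcomposing_η_isMonoidal (F.toPseudofunctor.obj a) (F.toPseudofunctor.obj b)
        (G.toPseudofunctor.obj b)
      inferInstance
    have h₂ : NatTrans.IsMonoidal (Functor.whiskerLeft (G.toPseudofunctor.mapFunctor a b)
        (Functor.LaxMonoidal.ε (precomposing (F.toPseudofunctor.obj a) _ _))) := inferInstance
    have h := isMonoidal_comp h₁ <| isMonoidal_comp (unitCompIso_isMonoidal _) <|
      isMonoidal_comp (isMonoidal_inv _ (unitCompIso_isMonoidal _)) h₂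
    refine Eq.mp (congrArg (fun τ => NatTrans.IsMonoidal τ) ?_) h
    ext f
    refine Eq.trans ?_ (congrArg₂ (fun u v => u ≫ v) (precomp_η _).symm
      (postcomp_ε _).symm)
    simp [unitCompIso]

end MonoidalTrans

/-! ### The `SMC`-data on the bicategory of `SMC`-functors. -/

namespace SMCFunctor

open scoped MonoidalCategory
open Functor.LaxMonoidal Functor.OplaxMonoidal

variable {B : Type u₁} [Bicategory.{w₁, v₁} B] {C : Type u₂} [Bicategory.{w₂, v₂} C]
  [SMCCategory B] [SMCCategory C]

/-- Operations on modifications are componentwise, so each equation between 2-cells reduces to an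
equation in `C` at every `b`. -/
theorem hom_ext {F G : SMCFunctor B C} {η θ : F ⟶ G} {M N : η ⟶ θ}
    (h : ∀ b, (modif M).app b = (modif N).app b) : M = N :=
  Pseudofunctor.StrongTrans.homCategory.ext (η := trans η) (θ := trans θ) h

@[reducible]
instance homMonoidalCategoryStruct (F G : SMCFunctor B C) : MonoidalCategoryStruct (F ⟶ G) where
  tensorObj η σ := MonoidalTrans.sum η σ
  tensorHom {η η' σ σ'} M N := StrongTransSum.sumMap (η := trans η) (η' := trans η')
    (σ := trans σ) (σ' := trans σ') M N
  whiskerLeft η σ σ' N := StrongTransSum.sumWhiskerLeft (trans η) (σ := trans σ) (σ' := trans σ') N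
  whiskerRight {η η'} M σ :=
    StrongTransSum.sumWhiskerRight (η := trans η) (η' := trans η') M (trans σ)
  tensorUnit := MonoidalTrans.zero F G
  associator η σ τ := MonoidalTrans.isoMk (StrongTransSum.sumAssociator (trans η) (trans σ) (trans τ))
  leftUnitor η := MonoidalTrans.isoMk (StrongTransSum.sumLeftUnitor (trans η))
  rightUnitor η := MonoidalTrans.isoMk (StrongTransSum.sumRightUnitor (trans η))

@[reducible]
instance homMonoidalCategory (F G : SMCFunctor B C) : MonoidalCategory (F ⟶ G) where
  tensorHom_def M N := hom_ext fun b =>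
    MonoidalCategory.tensorHom_def ((modif M).app b) ((modif N).app b)
  id_tensorHom_id η σ := hom_ext fun b =>
    MonoidalCategory.id_tensorHom_id ((trans η).app b) ((trans σ).app b)
  tensorHom_comp_tensorHom M N M' N' := hom_ext fun b =>
    MonoidalCategory.tensorHom_comp_tensorHom ((modif M).app b) ((modif N).app b)
      ((modif M').app b) ((modif N').app b)
  whiskerLeft_id η σ := hom_ext fun b =>
    MonoidalCategory.whiskerLeft_id ((trans η).app b) ((trans σ).app b)
  id_whiskerRight η σ := hom_ext fun b =>
    MonoidalCategory.id_whiskerRight ((trans η).app b) ((trans σ).app b)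
  associator_naturality M N P := hom_ext fun b =>
    MonoidalCategory.associator_naturality ((modif M).app b) ((modif N).app b) ((modif P).app b)
  leftUnitor_naturality M := hom_ext fun b =>
    MonoidalCategory.leftUnitor_naturality ((modif M).app b)
  rightUnitor_naturality M := hom_ext fun b =>
    MonoidalCategory.rightUnitor_naturality ((modif M).app b)
  pentagon η σ τ υ := hom_ext fun b =>
    MonoidalCategory.pentagon ((trans η).app b) ((trans σ).app b) ((trans τ).app b)
      ((trans υ).app b)
  triangle η σ := hom_ext fun b =>
    MonoidalCategory.triangle ((trans η).app b) ((trans σ).app b)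

@[reducible]
instance homSymmetricCategory (F G : SMCFunctor B C) : SymmetricCategory (F ⟶ G) where
  braiding η σ := MonoidalTrans.isoMk (StrongTransSum.sumBraiding (trans η) (trans σ))
  braiding_naturality_right η _ _ N := hom_ext fun b =>
    BraidedCategory.braiding_naturality_right ((trans η).app b) ((modif N).app b)
  braiding_naturality_left M σ := hom_ext fun b =>
    BraidedCategory.braiding_naturality_left ((modif M).app b) ((trans σ).app b)
  hexagon_forward η σ τ := hom_ext fun b =>
    BraidedCategory.hexagon_forward ((trans η).app b) ((trans σ).app b) ((trans τ).app b)
  hexagon_reverse η σ τ := hom_ext fun b =>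
    BraidedCategory.hexagon_reverse ((trans η).app b) ((trans σ).app b) ((trans τ).app b)
  symmetry η σ := hom_ext fun b =>
    SymmetricCategory.symmetry ((trans η).app b) ((trans σ).app b)

@[reducible]
instance postcomposingMonoidal (F G H : SMCFunctor B C) : (postcomposing F G H).Monoidal :=
  Functor.CoreMonoidal.toMonoidal
    { εIso := NatIso.ofComponents
        (fun η => MonoidalTrans.isoMk (StrongTransSum.compZero H.toPseudofunctor (trans η)))
        (fun {η η'} M => hom_ext fun b =>
          (Functor.LaxMonoidal.ε (postcomposing _ _ (H.toPseudofunctor.obj b))).naturality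
            ((modif M).app b))
      μIso := fun θ θ' => NatIso.ofComponents
        (fun η => MonoidalTrans.isoMk (StrongTransSum.compSum (trans η) (trans θ) (trans θ')))
        (fun {η η'} M => hom_ext fun b =>
          (μ (postcomposing _ _ _) ((trans θ).app b) ((trans θ').app b)).naturality
            ((modif M).app b))
      μIso_hom_natural_left := fun {θ₁ θ₂} M θ => by
        ext η
        exact hom_ext fun b => congrArg (fun τ => τ.app ((trans η).app b))
          (μ_natural_left (postcomposing _ _ _) ((modif M).app b) ((trans θ).app b))
      μIso_hom_natural_right := fun {θ₁ θ₂} θ M => by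
        ext η
        exact hom_ext fun b => congrArg (fun τ => τ.app ((trans η).app b))
          (μ_natural_right (postcomposing _ _ _) ((trans θ).app b) ((modif M).app b))
      associativity := fun θ₁ θ₂ θ₃ => by
        ext η
        exact hom_ext fun b => congrArg (fun τ => τ.app ((trans η).app b))
          (Functor.LaxMonoidal.associativity (postcomposing _ _ _) ((trans θ₁).app b)
            ((trans θ₂).app b) ((trans θ₃).app b))
      left_unitality := fun θ => by
        ext η
        exact hom_ext fun b => congrArg (fun τ => τ.app ((trans η).app b))
          (Functor.LaxMonoidal.left_unitality (postcomposing _ _ _) ((trans θ).app b))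
      right_unitality := fun θ => by
        ext η
        exact hom_ext fun b => congrArg (fun τ => τ.app ((trans η).app b))
          (Functor.LaxMonoidal.right_unitality (postcomposing _ _ _) ((trans θ).app b)) }

@[reducible]
instance precomposingMonoidal (F G H : SMCFunctor B C) : (precomposing F G H).Monoidal :=
  Functor.CoreMonoidal.toMonoidal
    { εIso := NatIso.ofComponents
        (fun θ => MonoidalTrans.isoMk (StrongTransSum.zeroComp F.toPseudofunctor (trans θ)))
        (fun {θ θ'} M => hom_ext fun b =>
          (Functor.LaxMonoidal.ε (precomposing (F.toPseudofunctor.obj b) _ _)).naturality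
            ((modif M).app b))
      μIso := fun η η' => NatIso.ofComponents
        (fun θ => MonoidalTrans.isoMk (StrongTransSum.sumComp (trans η) (trans η') (trans θ)))
        (fun {θ θ'} M => hom_ext fun b =>
          (μ (precomposing _ _ _) ((trans η).app b) ((trans η').app b)).naturality
            ((modif M).app b))
      μIso_hom_natural_left := fun {η₁ η₂} M η => by
        ext θ
        exact hom_ext fun b => congrArg (fun τ => τ.app ((trans θ).app b))
          (μ_natural_left (precomposing _ _ _) ((modif M).app b) ((trans η).app b))
      μIso_hom_natural_right := fun {η₁ η₂} η M => by
        ext θ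
        exact hom_ext fun b => congrArg (fun τ => τ.app ((trans θ).app b))
          (μ_natural_right (precomposing _ _ _) ((trans η).app b) ((modif M).app b))
      associativity := fun η₁ η₂ η₃ => by
        ext θ
        exact hom_ext fun b => congrArg (fun τ => τ.app ((trans θ).app b))
          (Functor.LaxMonoidal.associativity (precomposing _ _ _) ((trans η₁).app b)
            ((trans η₂).app b) ((trans η₃).app b))
      left_unitality := fun η => by
        ext θ
        exact hom_ext fun b => congrArg (fun τ => τ.app ((trans θ).app b))
          (Functor.LaxMonoidal.left_unitality (precomposing _ _ _) ((trans η).app b))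
      right_unitality := fun η => by
        ext θ
        exact hom_ext fun b => congrArg (fun τ => τ.app ((trans θ).app b))
          (Functor.LaxMonoidal.right_unitality (precomposing _ _ _) ((trans η).app b)) }

@[reducible]
instance smcData : SMCData (SMCFunctor B C) where
  homMonoidal := homMonoidalCategory
  homSymmetric := homSymmetricCategory
  postcomposingBraided F G H :=
    { braided := fun θ θ' => by
        ext η
        exact hom_ext fun b => congrArg (fun τ => τ.app ((trans η).app b))
          (Functor.LaxBraided.braided (F := postcomposing _ _ _) ((trans θ).app b)
            ((trans θ').app b)) }
  precomposingBraided F G H :=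
    { braided := fun η η' => by
        ext θ
        exact hom_ext fun b => congrArg (fun τ => τ.app ((trans θ).app b))
          (Functor.LaxBraided.braided (F := precomposing _ _ _) ((trans η).app b)
            ((trans η').app b)) }

end SMCFunctor

/-! ### Identities satisfied when some constraints are identities. -/

section

open scoped MonoidalCategory
open Functor.LaxMonoidal Functor.OplaxMonoidal

variable {D : Type u₁} [Category.{v₁} D] {E : Type u₂} [Category.{v₂} E]

/-- The compatibility of evaluation with composition has this shape, since the constraints of
evaluation are identities. -/
theorem id_comp_comp_id_eq_comp_map_id (P : D ⥤ E) {X : E} {Y : D} (x : X ⟶ P.obj Y) :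
    (𝟙 _ ≫ x) ≫ 𝟙 _ = x ≫ P.map (𝟙 Y) := by
  simp

theorem id_comp_comp_id_eq_tensor_id_comp_map_id [MonoidalCategory E] (P : D ⥤ E) {X X' : E} {Y : D}
    (x : X ⊗ X' ⟶ P.obj Y) :
    (𝟙 _ ≫ x) ≫ 𝟙 _ = (𝟙 X ⊗ₘ 𝟙 X') ≫ x ≫ P.map (𝟙 Y) := by
  simp

variable [MonoidalCategory E]

theorem id_whiskerRight_associator (X Y Z : E) :
    𝟙 (X ⊗ Y) ▷ Z ≫ 𝟙 _ ≫ (α_ X Y Z).hom = (α_ X Y Z).hom ≫ X ◁ 𝟙 (Y ⊗ Z) ≫ 𝟙 _ := by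
  simp

theorem leftUnitor_hom_eq (X : E) : (MonoidalCategoryStruct.leftUnitor X).hom =
    𝟙 (𝟙_ E) ▷ X ≫ 𝟙 _ ≫ (MonoidalCategoryStruct.leftUnitor X).hom := by
  simp

theorem rightUnitor_hom_eq (X : E) : (MonoidalCategoryStruct.rightUnitor X).hom =
    X ◁ 𝟙 (𝟙_ E) ≫ 𝟙 _ ≫ (MonoidalCategoryStruct.rightUnitor X).hom := by
  simp

variable [MonoidalCategory D] {D₂ : Type u₃} [Category.{v₃} D₂] [MonoidalCategory D₂]

theorem ε_map_id_unitCell (S : D ⥤ E) (T : D₂ ⥤ E) [S.Monoidal] [T.Monoidal] :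
    (Functor.LaxMonoidal.ε S ≫ S.map (𝟙 _)) ≫ unitCell S T =
      Functor.LaxMonoidal.ε T ≫ T.map (𝟙 _) := by
  simp [unitCell]

theorem μ_map_id_tensorCell (S : D ⥤ E) (T : D₂ ⥤ E) [S.Monoidal] [T.Monoidal] {x x' : D}
    {y y' : D₂} (u : S.obj x ⟶ T.obj y) (v : S.obj x' ⟶ T.obj y') :
    (μ S x x' ≫ S.map (𝟙 _)) ≫ tensorCell S T u v = (u ⊗ₘ v) ≫ μ T y y' ≫ T.map (𝟙 _) := by
  simp [tensorCell]

end

/-! ### The `SMC`-axioms and the evaluations. -/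

namespace SMCFunctor

open scoped MonoidalCategory
open Functor.LaxMonoidal Functor.OplaxMonoidal

variable {B : Type u₁} [Bicategory.{w₁, v₁} B] {C : Type u₂} [Bicategory.{w₂, v₂} C]
  [SMCCategory B] [SMCCategory C]

@[reducible]
instance smcCategory : SMCCategory (SMCFunctor B C) where
  postcomposing_μ θ θ' :=
    { unit := hom_ext fun b =>
        (SMCCategory.postcomposing_μ ((trans θ).app b) ((trans θ').app b)).unit
      tensor := fun η η' => hom_ext fun b =>
        (SMCCategory.postcomposing_μ ((trans θ).app b) ((trans θ').app b)).tensor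
          ((trans η).app b) ((trans η').app b) }
  precomposing_μ η η' :=
    { unit := hom_ext fun b =>
        (SMCCategory.precomposing_μ ((trans η).app b) ((trans η').app b)).unit
      tensor := fun θ θ' => hom_ext fun b =>
        (SMCCategory.precomposing_μ ((trans η).app b) ((trans η').app b)).tensor
          ((trans θ).app b) ((trans θ').app b) }
  postcomposing_ε F G H :=
    { unit := hom_ext fun b =>
        (SMCCategory.postcomposing_ε (F.toPseudofunctor.obj b) (G.toPseudofunctor.obj b)
          (H.toPseudofunctor.obj b)).unit
      tensor := fun η η' => hom_ext fun b =>
        (SMCCategory.postcomposing_ε (F.toPseudofunctor.obj b) (G.toPseudofunctor.obj b)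
          (H.toPseudofunctor.obj b)).tensor ((trans η).app b) ((trans η').app b) }
  precomposing_ε F G H :=
    { unit := hom_ext fun b =>
        (SMCCategory.precomposing_ε (F.toPseudofunctor.obj b) (G.toPseudofunctor.obj b)
          (H.toPseudofunctor.obj b)).unit
      tensor := fun θ θ' => hom_ext fun b =>
        (SMCCategory.precomposing_ε (F.toPseudofunctor.obj b) (G.toPseudofunctor.obj b)
          (H.toPseudofunctor.obj b)).tensor ((trans θ).app b) ((trans θ').app b) }
  associator_left F _ _ _ θ ι :=
    { unit := hom_ext fun b =>
        (SMCCategory.associator_left (F.toPseudofunctor.obj b) ((trans θ).app b)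
          ((trans ι).app b)).unit
      tensor := fun η η' => hom_ext fun b =>
        (SMCCategory.associator_left (F.toPseudofunctor.obj b) ((trans θ).app b)
          ((trans ι).app b)).tensor ((trans η).app b) ((trans η').app b) }
  associator_middle η ι :=
    { unit := hom_ext fun b =>
        (SMCCategory.associator_middle ((trans η).app b) ((trans ι).app b)).unit
      tensor := fun θ θ' => hom_ext fun b =>
        (SMCCategory.associator_middle ((trans η).app b) ((trans ι).app b)).tensor
          ((trans θ).app b) ((trans θ').app b) }
  associator_right η θ H :=
    { unit := hom_ext fun b =>
        (SMCCategory.associator_right ((trans η).app b) ((trans θ).app b)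
          (H.toPseudofunctor.obj b)).unit
      tensor := fun ι ι' => hom_ext fun b =>
        (SMCCategory.associator_right ((trans η).app b) ((trans θ).app b)
          (H.toPseudofunctor.obj b)).tensor ((trans ι).app b) ((trans ι').app b) }
  leftUnitor F G :=
    { unit := hom_ext fun b =>
        (SMCCategory.leftUnitor (F.toPseudofunctor.obj b) (G.toPseudofunctor.obj b)).unit
      tensor := fun η η' => hom_ext fun b =>
        (SMCCategory.leftUnitor (F.toPseudofunctor.obj b) (G.toPseudofunctor.obj b)).tensor
          ((trans η).app b) ((trans η').app b) }
  rightUnitor F G :=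
    { unit := hom_ext fun b =>
        (SMCCategory.rightUnitor (F.toPseudofunctor.obj b) (G.toPseudofunctor.obj b)).unit
      tensor := fun η η' => hom_ext fun b =>
        (SMCCategory.rightUnitor (F.toPseudofunctor.obj b) (G.toPseudofunctor.obj b)).tensor
          ((trans η).app b) ((trans η').app b) }

-- Sums are formed componentwise by definition, so identities serve as the constraints.
@[reducible]
instance evalBraided (b : B) (F G : SMCFunctor B C) : ((eval B C b).mapFunctor F G).Braided where
  __ := Functor.CoreMonoidal.toMonoidal
    { εIso := Iso.refl _
      μIso := fun _ _ => Iso.refl _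
      μIso_hom_natural_left := fun _ _ =>
        (Category.comp_id _).trans (Category.id_comp _).symm
      μIso_hom_natural_right := fun _ _ =>
        (Category.comp_id _).trans (Category.id_comp _).symm
      associativity := fun η σ τ =>
        id_whiskerRight_associator ((trans η).app b) ((trans σ).app b) ((trans τ).app b)
      left_unitality := fun η => leftUnitor_hom_eq ((trans η).app b)
      right_unitality := fun η => rightUnitor_hom_eq ((trans η).app b) }
  braided _ _ := (Category.id_comp _).trans (Category.comp_id _).symm

@[reducible]
instance evalStructure (b : B) : SMCFunctorStructure (eval B C b) where
  mapBraided := evalBraided b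
  mapComp_precomp η _ :=
    { unit := id_comp_comp_id_eq_comp_map_id ((precomposing _ _ _).obj ((trans η).app b))
        (Functor.LaxMonoidal.ε _)
      tensor := fun θ θ' =>
        id_comp_comp_id_eq_tensor_id_comp_map_id ((precomposing _ _ _).obj ((trans η).app b))
          (μ _ ((trans θ).app b) ((trans θ').app b)) }
  mapComp_postcomp _ _ _ θ :=
    { unit := id_comp_comp_id_eq_comp_map_id ((postcomposing _ _ _).obj ((trans θ).app b))
        (Functor.LaxMonoidal.ε _)
      tensor := fun η η' =>
        id_comp_comp_id_eq_tensor_id_comp_map_id ((postcomposing _ _ _).obj ((trans θ).app b))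
          (μ _ ((trans η).app b) ((trans η').app b)) }

/-- The cell of a sum at `f` is defined as a `tensorCell`, so `μ` of its source functor cancels
against the leading `δ`. -/
theorem evalNatTrans_isMonoidal (F G : SMCFunctor B C) {a b : B} (f : a ⟶ b) :
    NatTrans.IsMonoidal (evalNatTrans F G f) where
  unit := ε_map_id_unitCell ((precomposing _ _ _).obj (F.toPseudofunctor.map f))
    ((postcomposing _ _ _).obj (G.toPseudofunctor.map f))
  tensor η σ := μ_map_id_tensorCell ((precomposing _ _ _).obj (F.toPseudofunctor.map f))
    ((postcomposing _ _ _).obj (G.toPseudofunctor.map f)) ((trans η).naturality f).hom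
    ((trans σ).naturality f).hom

theorem isPointwise : IsPointwise B C :=
  ⟨evalStructure, fun _ _ _ => ⟨⟨rfl, rfl⟩, fun _ _ => ⟨rfl, rfl⟩⟩, evalNatTrans_isMonoidal⟩

end SMCFunctor

/-! ### Strictness. -/

section Strictness

/-- Naturality of `τ` presents `P.map f` as `Q.map f` conjugated by `eqToHom`s, which is the
criterion for equality of functors. -/
theorem functor_exists_eq_eqToHom {D : Type u₁} [Category.{v₁} D] {E : Type u₂} [Category.{v₂} E]
    {P Q : D ⥤ E} (τ : P ⟶ Q) (h : ∀ X, ∃ e : P.obj X = Q.obj X, τ.app X = eqToHom e) :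
    ∃ e : P = Q, τ = eqToHom e := by
  choose e he using h
  obtain rfl : P = Q := CategoryTheory.Functor.ext e fun X Y f => by
    have := τ.naturality f
    rw [he, he] at this
    rw [← Category.assoc, ← this, Category.assoc, eqToHom_trans, eqToHom_refl, Category.comp_id]
  exact ⟨rfl, by ext X; simp [he]⟩

theorem natTrans_app_eq_eqToHom {D : Type u₁} [Category.{v₁} D] {E : Type u₂} [Category.{v₂} E]
    {P Q : D ⥤ E} {τ : P ⟶ Q} (h : ∃ e : P = Q, τ = eqToHom e) (X : D) :
    ∃ e : P.obj X = Q.obj X, τ.app X = eqToHom e := by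
  obtain ⟨rfl, rfl⟩ := h
  exact ⟨rfl, rfl⟩

variable {B : Type u₁} [Bicategory.{w₁, v₁} B] {C : Type u₂} [Bicategory.{w₂, v₂} C]

/-- Once the components are identified, those of `M` are identities and its squares say that the
naturality 2-cells agree; the other fields are propositions. -/
theorem strongTrans_exists_eq_eqToHom {F G : B ⥤ᵖ C} {η θ : F ⟶ G} (M : η ⟶ θ)
    (h : ∀ b, ∃ e : η.app b = θ.app b, M.as.app b = eqToHom e) :
    ∃ e : η = θ, M = eqToHom e := by
  choose e he using h
  have key : η = θ := by
    -- Only the components of `M` and their squares are kept: the type of `M` mentions `η` and `θ`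
    -- and would obstruct identifying their components.
    have nat := fun {a b : B} (f : a ⟶ b) => M.as.naturality f
    generalize M.as.app = m at he nat
    clear M
    rcases η with ⟨a₁, n₁, _, _, _⟩
    rcases θ with ⟨a₂, n₂, _, _, _⟩
    obtain rfl : a₁ = a₂ := funext e
    have hn : @n₁ = @n₂ := by
      funext a b f
      ext
      have := nat f
      simp only [he, eqToHom_refl, Bicategory.whiskerLeft_id, Bicategory.id_whiskerRight] at this
      exact ((Category.id_comp _).symm.trans (this.trans (Category.comp_id _))).symm
    subst hn
    rfl
  subst key
  exact ⟨rfl, Pseudofunctor.StrongTrans.homCategory.ext fun b => he b⟩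

namespace SMCFunctor

open scoped MonoidalCategory
open Functor.LaxMonoidal

variable [SMCCategory B] [SMCCategory C]

/-- Being monoidal is a proposition, so equality of the underlying strong transformations suffices.
-/
theorem exists_eq_eqToHom {F G : SMCFunctor B C} {η θ : F ⟶ G} (M : η ⟶ θ)
    (h : ∀ b, ∃ e : (trans η).app b = (trans θ).app b, (modif M).app b = eqToHom e) :
    ∃ e : η = θ, M = eqToHom e := by
  obtain ⟨e, he⟩ := strongTrans_exists_eq_eqToHom (η := trans η) (θ := trans θ) M h
  obtain rfl : η = θ := by
    rcases η with ⟨t, _⟩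
    rcases θ with ⟨t', _⟩
    obtain rfl : t = t' := e
    rfl
  exact ⟨rfl, he⟩

theorem exists_functor_eq_eqToHom {F G F' G' : SMCFunctor B C} {P Q : (F ⟶ G) ⥤ (F' ⟶ G')}
    (τ : P ⟶ Q) (h : ∀ η b, ∃ e : (trans (P.obj η)).app b = (trans (Q.obj η)).app b,
      (modif (τ.app η)).app b = eqToHom e) :
    ∃ e : P = Q, τ = eqToHom e :=
  functor_exists_eq_eqToHom τ fun η => exists_eq_eqToHom _ (h η)

theorem bicategory_strict [Bicategory.Strict C] : Bicategory.Strict (SMCFunctor B C) := by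
  have hl {F G : SMCFunctor B C} (η : F ⟶ G) : ∃ e : 𝟙 F ≫ η = η, (Bicategory.leftUnitor η).hom = eqToHom e :=
    exists_eq_eqToHom _ fun b => ⟨Strict.id_comp ((trans η).app b),
      congrArg Iso.hom (Strict.leftUnitor_eqToIso ((trans η).app b))⟩
  have hr {F G : SMCFunctor B C} (η : F ⟶ G) : ∃ e : η ≫ 𝟙 G = η, (Bicategory.rightUnitor η).hom = eqToHom e :=
    exists_eq_eqToHom _ fun b => ⟨Strict.comp_id ((trans η).app b),
      congrArg Iso.hom (Strict.rightUnitor_eqToIso ((trans η).app b))⟩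
  have ha {F G H K : SMCFunctor B C} (η : F ⟶ G) (θ : G ⟶ H) (ι : H ⟶ K) :
      ∃ e : (η ≫ θ) ≫ ι = η ≫ θ ≫ ι, (α_ η θ ι).hom = eqToHom e :=
    exists_eq_eqToHom _ fun b =>
      ⟨Strict.assoc ((trans η).app b) ((trans θ).app b) ((trans ι).app b),
        congrArg Iso.hom (Strict.associator_eqToIso ((trans η).app b) ((trans θ).app b)
          ((trans ι).app b))⟩
  exact
    { id_comp := fun η => (hl η).1
      comp_id := fun η => (hr η).1
      assoc := fun η θ ι => (ha η θ ι).1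
      leftUnitor_eqToIso := fun η => Iso.ext (hl η).2
      rightUnitor_eqToIso := fun η => Iso.ext (hr η).2
      associator_eqToIso := fun η θ ι => Iso.ext (ha η θ ι).2 }

theorem homStrict [IsPCCategory C] (F G : SMCFunctor B C) : IsStrictMonoidalCategory (F ⟶ G) where
  associator_eq η σ τ := exists_eq_eqToHom _ fun b =>
    (IsPCCategory.homStrict _ _).associator_eq ((trans η).app b) ((trans σ).app b)
      ((trans τ).app b)
  leftUnitor_eq η := exists_eq_eqToHom _ fun b =>
    (IsPCCategory.homStrict _ _).leftUnitor_eq ((trans η).app b)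
  rightUnitor_eq η := exists_eq_eqToHom _ fun b =>
    (IsPCCategory.homStrict _ _).rightUnitor_eq ((trans η).app b)

theorem postcomposing_strict [IsPCCategory C] (F G H : SMCFunctor B C) :
    IsStrictMonoidal (postcomposing F G H) :=
  ⟨exists_functor_eq_eqToHom _ fun η b =>
    natTrans_app_eq_eqToHom (IsPCCategory.postcomposing_strict _ _ _).1 ((trans η).app b),
    fun θ θ' => exists_functor_eq_eqToHom _ fun η b =>
      natTrans_app_eq_eqToHom ((IsPCCategory.postcomposing_strict _ _ _).2 ((trans θ).app b)
        ((trans θ').app b)) ((trans η).app b)⟩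

theorem precomposing_unital [IsPCCategory C] (F G H : SMCFunctor B C) :
    IsStrictlyUnital (precomposing F G H) :=
  exists_functor_eq_eqToHom _ fun θ b =>
    natTrans_app_eq_eqToHom (IsPCCategory.precomposing_unital _ _ _) ((trans θ).app b)

theorem isPCCategory [h : IsPCCategory C] : IsPCCategory (SMCFunctor B C) where
  strict := have := h.strict; bicategory_strict
  homStrict := homStrict
  postcomposing_strict := postcomposing_strict
  precomposing_unital := precomposing_unital

end SMCFunctor

end Strictness

theorem corollary7p2 (B : Type u₁) [Bicategory.{w₁, v₁} B] [SMCCategory B]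
    (C : Type u₂) [Bicategory.{w₂, v₂} C] [SMCCategory C] :
    ∃ _ : SMCCategory (SMCFunctor B C),
      SMCFunctor.IsPointwise B C ∧ (IsPCCategory C → IsPCCategory (SMCFunctor B C)) :=
  ⟨SMCFunctor.smcCategory, SMCFunctor.isPointwise, fun _ => SMCFunctor.isPCCategory⟩
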